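/- \textbf{Setting.} Let $L$ be a finite set of offline vertices with weights $w_i>0$, and let online vertices $j=1,\dots,n$ arrive in this order; let $p_{ij}\in[0,1]$ be the success probability of the pair $(i,j)$, with $p_{ij}=0$ if $i$ and $j$ are not adjacent. The numbers $(p_{ij})_{i\in L}$ are revealed when $j$ arrives, and $j$ must then be assigned irrevocably to at most one $i\in L$. If $M_i$ is the set of online vertices assigned to $i$ in the assignment $M$, the reward of $M$ is $$c(M)=\sum_{i\in L} w_i\min\Bigl\{1,\sum_{j\in M_i}p_{ij}\Bigr\}.$$ Let $\mathrm{OPT}$ be the maximum of $c(M)$ over all assignments $M$. \textbf{Algorithm.} Put $W_i=w_i$, $w_{ij}=w_ip_{ij}$ and $g(y)=e^{y-1}/(1-1/e)$. The algorithm keeps random variables $Y_i$, $B_i$, initially $0$. When $j$ arrives, let $\mathcal E$ be the realized assignment of the earlier vertices, let $$m_i=\min\Bigl\{w_{ij},\max\bigl\{0,\,W_i-\textstyle\sum_{j':(i,j')\in\mathcal E}w_{ij'}\bigr\}\Bigr\},$$ let $(Y_i\mid\mathcal E)$ be the value of $Y_i$ at the arrival of $j$, and start with $x_{ij}=0$ for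 all $i$. If $(Y_i\mid\mathcal E)\ge 1$ for all $i\in L$, nothing happens and $j$ stays unassigned. Otherwise the $x_{ij}$ are increased continuously until $\sum_i x_{ij}=1$, where at each moment only vertices $i$ maximizing $$m_i\Bigl(1-\frac{(B_i\mid\mathcal E)}{W_i}\Bigr)$$ are increased. Meanwhile $Y_i=(Y_i\mid\mathcal E)+\frac{m_i}{W_i}X_{ij}$ and $dB_i=m_i\,g(Y_i)\,dx_{ij}$. Here $X_{ij}$ is the $0$-$1$ indicator of assigning $j$ to $i$; during the increase it can only switch from $0$ to $1$, and it equals $1$ with probability $x_{ij}$ (the current value). $(B_i\mid\mathcal E)$ is the conditional expectation, given $\mathcal E$, of the current value of $B_i$. At the end, $j$ is assigned to $i$ with probability $x_{ij}$ for every $i$ (to at most one $i$, and to none with probability $1-\sum_i x_{ij}$). \textbf{Statement.} The algorithm is $(1-1/e)$-competitive for online matching with stochastic rewards and vanishing probabilities: for every $\varepsilon>0$ there is $\delta>0$ such that on every instance with $\max_{i,j}p_{ij}\le\delta$ (for any $L$, $n$, $w$, $p$) the algorithm has a run, and each of its runs (that is, whatever choices the rule above leaves open in case of ties) outputs a random assignment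 $M$ with $$\mathbb E[c(M)]\ \ge\ \Bigl(1-\frac1e-\varepsilon\Bigr)\,\mathrm{OPT}.$$ -/

import Mathlib

open Finset

noncomputable section

namespace OnlineMatching

/-- An assignment of the online vertices `Fin n` (listed in order of arrival) to offline vertices:
each online vertex gets at most one offline vertex, `none` meaning that it stays unassigned. -/
abbrev Assignment (L : Type*) (n : ℕ) := Fin n → Option L

/-- The 0-1 variable `X_{ij}`: online vertex `j` is assigned to `i` in `E`. -/
def X {L : Type*} [DecidableEq L] {n : ℕ} (E : Assignment L n) (i : L) (j : Fin n) : ℝ :=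
  if E j = some i then 1 else 0

/-- Online weighted matching with additive budgets: edge weights `w_{ij}` (zero on non-edges) and
budgets `W_i`. -/
structure BudgetInstance (L : Type*) (n : ℕ) where
  weight : L → Fin n → ℝ
  budget : L → ℝ
  weight_nonneg : ∀ i j, 0 ≤ weight i j
  budget_pos : ∀ i, 0 < budget i

/-- Online matching with stochastic rewards: weights `w_i` of the offline vertices and success
probabilities `p_{ij}` (zero on non-edges). -/
structure StochasticInstance (L : Type*) (n : ℕ) where
  weight : L → ℝ
  prob : L → Fin n → ℝ
  weight_pos : ∀ i, 0 < weight i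
  prob_nonneg : ∀ i j, 0 ≤ prob i j
  prob_le_one : ∀ i j, prob i j ≤ 1

namespace StochasticInstance

variable {L : Type*} [Fintype L] [DecidableEq L] {n : ℕ}

/-- The reward `c(M) = ∑_i w_i min {1, ∑_{j ∈ M_i} p_{ij}}`. -/
def reward (I : StochasticInstance L n) (M : Assignment L n) : ℝ :=
  ∑ i, I.weight i * min 1 (∑ j with M j = some i, I.prob i j)

/-- The offline optimum: the largest reward of an assignment. -/
def opt (I : StochasticInstance L n) : ℝ :=
  (univ : Finset (Assignment L n)).sup' univ_nonempty I.reward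

end StochasticInstance

/-- A stochastic-reward instance as an additive-budget instance: `w_i min {1, ∑ p_{ij}}` is
`min {w_i, ∑ w_i p_{ij}}`, so the edge weights are `w_i p_{ij}` and the budgets `w_i`. -/
def StochasticInstance.toBudget {L : Type*} {n : ℕ} (I : StochasticInstance L n) :
    BudgetInstance L n where
  weight i j := I.weight i * I.prob i j
  budget := I.weight
  weight_nonneg i j := mul_nonneg (I.weight_pos i).le (I.prob_nonneg i j)
  budget_pos := I.weight_pos

/-- `g(y) = e^{y-1} / (1 - 1/e)`. -/
def g (y : ℝ) : ℝ := Real.exp (y - 1) / (1 - 1 / Real.exp 1)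

/-! ### The primal-dual algorithm for additive budgets

Below, `E` is a realization of the random assignment. Every quantity attached to the arrival of `j`
reads only the entries of `E` before `j`. A family `x` of fractions records, as `x j E i`, the final
value of `x_{ij}` (the probability of assigning `j` to `i`) when the earlier vertices were assigned
as in `E`. The variables `A_j` of the algorithm are never read by it, so they are not modelled. -/

namespace BudgetInstance

variable {L : Type*} [DecidableEq L] {n : ℕ}

/-- The total weight `∑_{j' : (i,j') ∈ E} w_{ij'}` assigned to `i` before `j` arrives. -/
def load (I : BudgetInstance L n) (E : Assignment L n) (j : Fin n) (i : L) : ℝ :=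
  ∑ k ∈ Iio j, I.weight i k * X E i k

/-- `min {w_{ij}, max {0, W_i - ∑_{j' : (i,j') ∈ E} w_{ij'}}}`. -/
def gain (I : BudgetInstance L n) (E : Assignment L n) (j : Fin n) (i : L) : ℝ :=
  min (I.weight i j) (max 0 (I.budget i - I.load E j i))

/-- `(Y_i | E)` at the arrival of `j`: starting from `0`, each earlier `k` has added
`gain / W_i * X_{ik}`. -/
def Y (I : BudgetInstance L n) (E : Assignment L n) (j : Fin n) (i : L) : ℝ :=
  ∑ k ∈ Iio j, I.gain E k i / I.budget i * X E i k

/-- The expected increase of `B_i` while `x_{ij}` grows from `0` to `x` under the rule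
`dB_i = gain * g(Y_i) dx_{ij}`, where `Y_i = (Y_i | E) + gain / W_i * X_{ij}`, if `X_{ij} = 1` has
(conditional) probability `r * s` at the moment when `x_{ij} = s`. -/
def increaseB (I : BudgetInstance L n) (E : Assignment L n) (j : Fin n) (i : L) (r x : ℝ) : ℝ :=
  ∫ s in (0 : ℝ)..x, I.gain E j i *
    ((1 - r * s) * g (I.Y E j i) + r * s * g (I.Y E j i + I.gain E j i / I.budget i))

/-- `(B_i | E)` at the arrival of `j`, the conditional expectation of `B_i` given the realized
assignment of the earlier vertices. While `x_{ik}` grows, `X_{ik}` is a 0-1 variable that can only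
switch from `0` to `1` and has probability `s` of being `1` when `x_{ik} = s`; hence, given its
final value `X_{ik}` and the final value `x` of `x_{ik}`, it is `1` at that moment with conditional
probability `X_{ik} * s / x`. -/
def B (I : BudgetInstance L n) (x : Fin n → Assignment L n → L → ℝ) (E : Assignment L n)
    (j : Fin n) (i : L) : ℝ :=
  ∑ k ∈ Iio j, I.increaseB E k i (X E i k / x k E i) (x k E i)

/-- The quantity `gain * (1 - (B_i | E) / W_i)` maximized by the algorithm, at a moment of the
while loop for `j` when the current fractions `(x_{ij})_i` are `ξ`. At this moment `X_{ij}` is not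
yet realized, and is `1` with probability `ξ i`. -/
def score (I : BudgetInstance L n) (x : Fin n → Assignment L n → L → ℝ) (E : Assignment L n)
    (j : Fin n) (ξ : L → ℝ) (i : L) : ℝ :=
  I.gain E j i * (1 - (I.B x E j i + I.increaseB E j i 1 (ξ i)) / I.budget i)

/-- `ξ t`, for `0 ≤ t ≤ 1`, is an evolution of the fractions `(x_{ij})_i` in the while loop for `j`,
parametrized by their sum: the fractions start at `0`, grow continuously until their sum is `1`, and
`x_{ij}` grows only at moments when `i` is in the arg max of the current scores. (Ties need no
further rule: a score with positive gain strictly decreases when its fraction grows, so that tied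
vertices with positive gain have to grow together; vertices with zero gain keep score `0`.) -/
structure IsLoop [Fintype L] (I : BudgetInstance L n) (x : Fin n → Assignment L n → L → ℝ)
    (E : Assignment L n) (j : Fin n) (ξ : ℝ → L → ℝ) : Prop where
  start : ∀ i, ξ 0 i = 0
  mono : ∀ i, MonotoneOn (fun t => ξ t i) (Set.Icc 0 1)
  total : ∀ t ∈ Set.Icc (0 : ℝ) 1, ∑ i, ξ t i = t
  greedy : ∀ i, ∀ s ∈ Set.Icc (0 : ℝ) 1, ∀ t ∈ Set.Icc (0 : ℝ) 1, s < t → ξ s i < ξ t i →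
    ∃ u ∈ Set.Icc s t, ∀ k, I.score x E j (ξ u) k ≤ I.score x E j (ξ u) i

/-- `x` is a run of the algorithm: the fractions for `j` depend only on the realized assignment of
the earlier vertices; they stay `0` if `(Y_i | E) ≥ 1` for all `i`, and otherwise they result from
the while loop. -/
structure IsRun [Fintype L] (I : BudgetInstance L n) (x : Fin n → Assignment L n → L → ℝ) :
    Prop where
  adapted : ∀ j E E', (∀ k < j, E k = E' k) → x j E = x j E'
  idle : ∀ j E, (∀ i, 1 ≤ I.Y E j i) → ∀ i, x j E i = 0
  loop : ∀ j E, (∃ i, I.Y E j i < 1) → ∃ ξ : ℝ → L → ℝ, I.IsLoop x E j ξ ∧ x j E = ξ 1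

end BudgetInstance

/-- The probability that the final assignment is `M`: given the assignment of the earlier vertices,
`j` is assigned to `i` with probability `x_{ij}`, and to no vertex with the remaining probability. -/
def law {L : Type*} [Fintype L] {n : ℕ} (x : Fin n → Assignment L n → L → ℝ)
    (M : Assignment L n) : ℝ :=
  ∏ j, (M j).elim (1 - ∑ i, x j M i) (fun i => x j M i)

/-- The expectation of `c(M)` for the random final assignment `M`. -/
def expectedReward {L : Type*} [Fintype L] {n : ℕ} (x : Fin n → Assignment L n → L → ℝ)
    (c : Assignment L n → ℝ) : ℝ :=
  ∑ M, law x M * c M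

end OnlineMatching

end


/-! Duality for the fractional relaxation: charge `W_i B_i` to the offline vertices and the maximal
score to each arrival. The terms `dB_i` are calibrated so that `g 1 = 1 / (1 - 1/e)` times the
expected reward pays for the expected dual, up to errors of the order of the weight-to-budget
ratio. The algorithm bids with `(B_i | E)`, whereas dual feasibility is about the expectation of
`B_i`; the two differ by the martingale `N` that compares the `X_{ij}` with their probabilities
`x_{ij}`. Its increments are bounded by the weight-to-budget ratio `δ` and the compensated level of
`i` stays bounded, so `E N² = O(δ)` and the discrepancy vanishes with `δ`. Weighting `|N|` by the
increments of the level costs only `O(√δ)` times the level itself, by a discrete Tanaka formula, so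
the error is relative to the reward of the algorithm. -/

noncomputable section

namespace OnlineMatching

/-! ### Expectations over the random assignment -/

section Expectation

variable {L : Type*} {n : ℕ}

/-- The arrivals before time `t`; time `j.castSucc` is just before the arrival of `j` and time
`j.succ` just after it. -/
def past (t : Fin (n + 1)) : Set (Fin n) := Fin.castSucc ⁻¹' Set.Iio t

/-- A family attached to the arrivals is predictable if each member only reads the assignment of
the earlier arrivals. -/
def IsPredictable {β : Type*} (c : Fin n → Assignment L n → β) : Prop :=
  ∀ j, DependsOn (c j) (past j.castSucc)

theorem past_mono : Monotone (past (n := n)) := fun _ _ hst _ hk => lt_of_lt_of_le hk hst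

theorem mem_past_succ (j : Fin n) : j ∈ past j.succ := Fin.castSucc_lt_succ

theorem notMem_past_castSucc (j : Fin n) : j ∉ past j.castSucc := lt_irrefl j.castSucc

theorem past_castSucc_subset_succ (j : Fin n) : past j.castSucc ⊆ past j.succ :=
  past_mono Fin.castSucc_lt_succ.le

theorem update_eq_of_dependsOn {ι κ β : Type*} [DecidableEq ι] {F : (ι → κ) → β} {s : Set ι}
    (hF : DependsOn F s) {j : ι} (hj : j ∉ s) (M : ι → κ) (o : κ) :
    F (Function.update M j o) = F M :=
  hF fun _ hk => Function.update_of_ne (ne_of_mem_of_not_mem hk hj) _ _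

theorem sum_sum_update {ι κ β : Type*} [Fintype ι] [DecidableEq ι] [Fintype κ] [AddCommMonoid β]
    (j : ι) (Φ : (ι → κ) → β) :
    ∑ M, ∑ o, Φ (Function.update M j o) = Fintype.card κ • ∑ M, Φ M := by
  have swap_involutive : Function.Involutive
      (fun p : (ι → κ) × κ => (Function.update p.1 j p.2, p.1 j)) := by
    rintro ⟨M, o⟩
    simp
  have h := Equiv.sum_comp swap_involutive.toPerm fun p : (ι → κ) × κ => Φ p.1
  simp only [Fintype.sum_prod_type, Function.Involutive.coe_toPerm, sum_const, card_univ] at h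
  rw [h, smul_sum]

theorem dependsOn_X [DecidableEq L] (i : L) (j : Fin n) :
    DependsOn (fun M : Assignment L n => X M i j) (past j.succ) := by
  intro M M' h
  simp only [X, h j (mem_past_succ j)]

variable [Fintype L] {x : Fin n → Assignment L n → L → ℝ}

/-- The probability of the choice `o` at the arrival of `j`, given the earlier choices in `M`. -/
def stepProb (x : Fin n → Assignment L n → L → ℝ) (j : Fin n) (M : Assignment L n)
    (o : Option L) : ℝ :=
  o.elim (1 - ∑ i, x j M i) (fun i => x j M i)

theorem sum_stepProb (x : Fin n → Assignment L n → L → ℝ) (j : Fin n) (M : Assignment L n) :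
    ∑ o, stepProb x j M o = 1 := by
  simp [stepProb, Fintype.sum_option]

theorem isPredictable_stepProb (hx : IsPredictable x) : IsPredictable (stepProb x) := by
  intro j M M' h
  funext o
  simp only [stepProb, hx j h]

/-- The law of the assignment that follows `x` before time `t` and makes uniform choices from then
on. It computes the expectation of whatever is known at time `t`. -/
def lawUntil (x : Fin n → Assignment L n → L → ℝ) (t : Fin (n + 1)) (M : Assignment L n) : ℝ :=
  ∏ k, if k.castSucc < t then stepProb x k M (M k) else (Fintype.card (Option L) : ℝ)⁻¹

theorem lawUntil_last (x : Fin n → Assignment L n → L → ℝ) : lawUntil x (Fin.last n) = law x := by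
  funext M
  simp [lawUntil, law, stepProb, Fin.castSucc_lt_last]

theorem sum_lawUntil_zero (x : Fin n → Assignment L n → L → ℝ) : ∑ M, lawUntil x 0 M = 1 := by
  simp only [lawUntil, Fin.not_lt_zero, ite_false, prod_const, card_univ, sum_const,
    Fintype.card_fun, Fintype.card_fin, nsmul_eq_mul, Nat.cast_pow]
  rw [← mul_pow, mul_inv_cancel₀ (Nat.cast_ne_zero.2 Fintype.card_ne_zero), one_pow]

theorem lawUntil_succ (x : Fin n → Assignment L n → L → ℝ) (j : Fin n) (M : Assignment L n) :
    lawUntil x j.succ M =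
      Fintype.card (Option L) * (lawUntil x j.castSucc M * stepProb x j M (M j)) := by
  have factor_of_ne : ∀ k ∈ univ.erase j, (k.castSucc < j.succ ↔ k.castSucc < j.castSucc) := by
    intro k hk
    rw [Fin.castSucc_lt_succ_iff, Fin.castSucc_lt_castSucc_iff, (ne_of_mem_erase hk).le_iff_lt]
  simp only [lawUntil]
  rw [← mul_prod_erase _ _ (mem_univ j), ← mul_prod_erase _ _ (mem_univ j),
    prod_congr rfl fun k hk => if_congr (factor_of_ne k hk) rfl rfl,
    if_pos Fin.castSucc_lt_succ, if_neg (lt_irrefl _)]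
  field_simp

theorem dependsOn_lawUntil (hx : IsPredictable x) (t : Fin (n + 1)) :
    DependsOn (lawUntil x t) (past t) := by
  intro M M' h
  refine prod_congr rfl fun k _ => ?_
  split_ifs with hk
  · rw [isPredictable_stepProb hx k fun l hl => h l (past_mono hk.le hl), h k hk]
  · rfl

theorem sum_lawUntil_succ_mul (hx : IsPredictable x) (j : Fin n) (F : Assignment L n → ℝ) :
    ∑ M, lawUntil x j.succ M * F M =
      ∑ M, lawUntil x j.castSucc M * ∑ o, stepProb x j M o * F (Function.update M j o) := by
  calc ∑ M, lawUntil x j.succ M * F M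
      = Fintype.card (Option L) • ∑ M, lawUntil x j.castSucc M * stepProb x j M (M j) * F M := by
        rw [nsmul_eq_mul, mul_sum]
        simp only [lawUntil_succ, mul_assoc]
    _ = ∑ M, ∑ o, lawUntil x j.castSucc (Function.update M j o) *
          stepProb x j (Function.update M j o) (Function.update M j o j) *
            F (Function.update M j o) :=
        (sum_sum_update j fun M : Assignment L n =>
          lawUntil x j.castSucc M * stepProb x j M (M j) * F M).symm
    _ = ∑ M, lawUntil x j.castSucc M * ∑ o, stepProb x j M o * F (Function.update M j o) := by
        simp only [update_eq_of_dependsOn (dependsOn_lawUntil hx _) (notMem_past_castSucc j),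
          update_eq_of_dependsOn (isPredictable_stepProb hx j) (notMem_past_castSucc j),
          Function.update_self, mul_assoc, mul_sum]

theorem expectedReward_eq_sum_lawUntil (hx : IsPredictable x) {t : Fin (n + 1)}
    {F : Assignment L n → ℝ} (hF : DependsOn F (past t)) :
    expectedReward x F = ∑ M, lawUntil x t M * F M := by
  suffices ∀ t', t ≤ t' → ∑ M, lawUntil x t' M * F M = ∑ M, lawUntil x t M * F M by
    rw [← this (Fin.last n) (Fin.le_last t), lawUntil_last, expectedReward]
  intro t'
  induction t' using Fin.induction with
  | zero => intro h; rw [Fin.le_zero_iff.1 h]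
  | succ j ih =>
    intro h
    rcases h.eq_or_lt with rfl | hlt
    · rfl
    · have hle : t ≤ j.castSucc := Fin.le_castSucc_iff.2 hlt
      have hj : j ∉ past t := hle.not_gt
      rw [← ih hle, sum_lawUntil_succ_mul hx]
      simp only [update_eq_of_dependsOn hF hj, ← sum_mul, sum_stepProb, one_mul]

theorem expectedReward_const (hx : IsPredictable x) (c : ℝ) :
    expectedReward x (fun _ => c) = c := by
  rw [expectedReward_eq_sum_lawUntil hx (t := 0) fun _ _ _ => rfl, ← sum_mul, sum_lawUntil_zero,
    one_mul]

theorem expectedReward_mul_X [DecidableEq L] (hx : IsPredictable x) (i : L) (j : Fin n)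
    {F : Assignment L n → ℝ} (hF : DependsOn F (past j.castSucc)) :
    expectedReward x (fun M => F M * X M i j) = expectedReward x (fun M => F M * x j M i) := by
  have left_known : DependsOn (fun M => F M * X M i j) (past j.succ) := fun M M' h => by
    simp only [hF.mono (past_castSucc_subset_succ j) h, dependsOn_X i j h]
  have right_known : DependsOn (fun M => F M * x j M i) (past j.castSucc) := fun M M' h => by
    simp only [hF h, hx j h]
  have mean_choice (M : Assignment L n) :
      ∑ o, stepProb x j M o * (F (Function.update M j o) * X (Function.update M j o) i j) =
        F M * x j M i := by
    simp [update_eq_of_dependsOn hF (notMem_past_castSucc j), X, stepProb, mul_comm]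
  rw [expectedReward_eq_sum_lawUntil hx left_known, sum_lawUntil_succ_mul hx,
    expectedReward_eq_sum_lawUntil hx right_known]
  simp only [mean_choice]

theorem expectedReward_add (x : Fin n → Assignment L n → L → ℝ) (F F' : Assignment L n → ℝ) :
    expectedReward x (fun M => F M + F' M) = expectedReward x F + expectedReward x F' := by
  simp only [expectedReward, mul_add, sum_add_distrib]

theorem expectedReward_sub (x : Fin n → Assignment L n → L → ℝ) (F F' : Assignment L n → ℝ) :
    expectedReward x (fun M => F M - F' M) = expectedReward x F - expectedReward x F' := by
  simp only [expectedReward, mul_sub, sum_sub_distrib]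

theorem expectedReward_const_mul (x : Fin n → Assignment L n → L → ℝ) (c : ℝ)
    (F : Assignment L n → ℝ) :
    expectedReward x (fun M => c * F M) = c * expectedReward x F := by
  simp only [expectedReward, mul_left_comm _ c, ← mul_sum]

theorem expectedReward_sum {ι : Type*} (s : Finset ι) (x : Fin n → Assignment L n → L → ℝ)
    (F : ι → Assignment L n → ℝ) :
    expectedReward x (fun M => ∑ i ∈ s, F i M) = ∑ i ∈ s, expectedReward x (F i) := by
  simp only [expectedReward, mul_sum]
  exact sum_comm

/-- Fractions that only depend on the past and form a sub-probability vector at every arrival. -/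
structure IsStrategy (x : Fin n → Assignment L n → L → ℝ) : Prop where
  predictable : IsPredictable x
  nonneg : ∀ j M i, 0 ≤ x j M i
  sum_le_one : ∀ j M, ∑ i, x j M i ≤ 1

theorem IsStrategy.le_one (hx : IsStrategy x) (j : Fin n) (M : Assignment L n) (i : L) :
    x j M i ≤ 1 :=
  (single_le_sum (fun k _ => hx.nonneg j M k) (mem_univ i)).trans (hx.sum_le_one j M)

theorem IsStrategy.law_nonneg (hx : IsStrategy x) (M : Assignment L n) : 0 ≤ law x M := by
  refine prod_nonneg fun j _ => ?_
  cases M j with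
  | none => exact sub_nonneg.2 (hx.sum_le_one j M)
  | some i => exact hx.nonneg j M i

theorem IsStrategy.expectedReward_mono (hx : IsStrategy x) : Monotone (expectedReward x) :=
  fun _ _ h => sum_le_sum fun M _ => mul_le_mul_of_nonneg_left (h M) (hx.law_nonneg M)

end Expectation

/-! ### Martingales of the choices for one offline vertex -/

section Martingale

variable {L : Type*} {n : ℕ}

theorem partialSum_eq_sum {β : Type*} [AddCommMonoid β] (f : Fin n → β) (t : Fin (n + 1)) :
    Fin.partialSum f t = ∑ k with k.castSucc < t, f k := by
  induction t using Fin.induction with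
  | zero => simp
  | succ j ih =>
    have filter_succ : ({k | k.castSucc < j.succ} : Finset (Fin n)) =
        cons j {k | k.castSucc < j.castSucc} (by simp) := by
      ext k
      simp [le_iff_eq_or_lt]
    rw [Fin.partialSum_succ, ih, filter_succ, sum_cons, add_comm]

theorem partialSum_castSucc {β : Type*} [AddCommMonoid β] (f : Fin n → β) (j : Fin n) :
    Fin.partialSum f j.castSucc = ∑ k ∈ Iio j, f k := by
  simp [partialSum_eq_sum, filter_gt_eq_Iio]

theorem partialSum_last {β : Type*} [AddCommMonoid β] (f : Fin n → β) :
    Fin.partialSum f (Fin.last n) = ∑ k, f k := by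
  simp [partialSum_eq_sum, Fin.castSucc_lt_last]

/-- A process, indexed by time, is adapted if at each time it only reads the past. -/
def IsAdapted {β : Type*} (F : Fin (n + 1) → Assignment L n → β) : Prop :=
  ∀ t, DependsOn (F t) (past t)

/-- The sum of `c` over the earlier arrivals that are assigned to `i`. -/
def realized [DecidableEq L] (i : L) (c : Fin n → Assignment L n → ℝ) (t : Fin (n + 1))
    (M : Assignment L n) : ℝ :=
  Fin.partialSum (fun k => c k M * X M i k) t

/-- The predictable part of `realized`, in which each choice is replaced by its conditional
probability. -/
def compensator (x : Fin n → Assignment L n → L → ℝ) (i : L) (c : Fin n → Assignment L n → ℝ)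
    (t : Fin (n + 1)) (M : Assignment L n) : ℝ :=
  Fin.partialSum (fun k => c k M * x k M i) t

/-- The martingale by which the predictable part of `realized` exceeds it. -/
def noise [DecidableEq L] (x : Fin n → Assignment L n → L → ℝ) (i : L)
    (c : Fin n → Assignment L n → ℝ) (t : Fin (n + 1)) (M : Assignment L n) : ℝ :=
  compensator x i c t M - realized i c t M

theorem compensator_zero (x : Fin n → Assignment L n → L → ℝ) (i : L)
    (c : Fin n → Assignment L n → ℝ) (M : Assignment L n) : compensator x i c 0 M = 0 :=
  Fin.partialSum_zero _

theorem compensator_succ (x : Fin n → Assignment L n → L → ℝ) (i : L)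
    (c : Fin n → Assignment L n → ℝ) (j : Fin n) (M : Assignment L n) :
    compensator x i c j.succ M = compensator x i c j.castSucc M + c j M * x j M i :=
  Fin.partialSum_succ _ j

variable [DecidableEq L]

theorem X_eq_zero_or_one (M : Assignment L n) (i : L) (j : Fin n) : X M i j = 0 ∨ X M i j = 1 :=
  (ite_eq_or_eq _ _ _).symm

theorem X_nonneg (M : Assignment L n) (i : L) (j : Fin n) : 0 ≤ X M i j := by
  rcases X_eq_zero_or_one M i j with h | h <;> simp [h]

theorem X_le_one (M : Assignment L n) (i : L) (j : Fin n) : X M i j ≤ 1 := by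
  rcases X_eq_zero_or_one M i j with h | h <;> simp [h]

theorem X_sq (M : Assignment L n) (i : L) (j : Fin n) : X M i j ^ 2 = X M i j := by
  rcases X_eq_zero_or_one M i j with h | h <;> simp [h]

theorem realized_zero (i : L) (c : Fin n → Assignment L n → ℝ) (M : Assignment L n) :
    realized i c 0 M = 0 :=
  Fin.partialSum_zero _

theorem realized_succ (i : L) (c : Fin n → Assignment L n → ℝ) (j : Fin n) (M : Assignment L n) :
    realized i c j.succ M = realized i c j.castSucc M + c j M * X M i j :=
  Fin.partialSum_succ _ j

variable {x : Fin n → Assignment L n → L → ℝ} {i : L} {c : Fin n → Assignment L n → ℝ}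

theorem noise_zero (x : Fin n → Assignment L n → L → ℝ) (i : L)
    (c : Fin n → Assignment L n → ℝ) (M : Assignment L n) : noise x i c 0 M = 0 := by
  rw [noise, compensator_zero, realized_zero, sub_zero]

theorem noise_succ (x : Fin n → Assignment L n → L → ℝ) (i : L)
    (c : Fin n → Assignment L n → ℝ) (j : Fin n) (M : Assignment L n) :
    noise x i c j.succ M = noise x i c j.castSucc M + c j M * (x j M i - X M i j) := by
  rw [noise, compensator_succ, realized_succ, noise]
  ring

theorem realized_nonneg (hc : ∀ j M, 0 ≤ c j M) (t : Fin (n + 1)) (M : Assignment L n) :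
    0 ≤ realized i c t M := by
  induction t using Fin.induction with
  | zero => exact (realized_zero i c M).ge
  | succ j ih =>
    rw [realized_succ]
    exact add_nonneg ih (mul_nonneg (hc j M) (X_nonneg M i j))

theorem isAdapted_realized (hc : IsPredictable c) : IsAdapted (realized i c) := by
  intro t M M' h
  induction t using Fin.induction with
  | zero => simp only [realized_zero]
  | succ j ih =>
    have hpast : ∀ k ∈ past j.castSucc, M k = M' k :=
      fun k hk => h k (past_castSucc_subset_succ j hk)
    simp only [realized_succ, ih hpast, hc j hpast, dependsOn_X i j h]

theorem isAdapted_noise (hx : IsPredictable x) (hc : IsPredictable c) :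
    IsAdapted (noise x i c) := by
  intro t M M' h
  induction t using Fin.induction with
  | zero => simp only [noise_zero]
  | succ j ih =>
    have hpast : ∀ k ∈ past j.castSucc, M k = M' k :=
      fun k hk => h k (past_castSucc_subset_succ j hk)
    simp only [noise_succ, ih hpast, hc j hpast, hx j hpast, dependsOn_X i j h]

variable [Fintype L]

theorem expectedReward_noise (hx : IsPredictable x) (hc : IsPredictable c) (t : Fin (n + 1)) :
    expectedReward x (noise x i c t) = 0 := by
  induction t using Fin.induction with
  | zero => simp only [expectedReward, noise_zero, mul_zero, sum_const_zero]
  | succ j ih =>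
    calc expectedReward x (noise x i c j.succ)
        = expectedReward x (fun M => noise x i c j.castSucc M +
            (c j M * x j M i - c j M * X M i j)) := by
          simp only [funext (noise_succ x i c j), mul_sub]
      _ = 0 := by
          rw [expectedReward_add, ih, expectedReward_sub, expectedReward_mul_X hx i j (hc j),
            sub_self, add_zero]

theorem expectedReward_compensator (hx : IsPredictable x) (hc : IsPredictable c)
    (t : Fin (n + 1)) :
    expectedReward x (compensator x i c t) = expectedReward x (realized i c t) :=
  sub_eq_zero.1 <| (expectedReward_sub x _ _).symm.trans (expectedReward_noise hx hc t)

variable {κ : ℝ}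

theorem noise_sq_le (hx : IsStrategy x) (hc₀ : ∀ j M, 0 ≤ c j M) (hcκ : ∀ j M, c j M ≤ κ)
    (t : Fin (n + 1)) (M : Assignment L n) :
    noise x i c t M ^ 2 ≤ κ * compensator x i c t M + noise x i (fun j M =>
      2 * noise x i c j.castSucc M * c j M - c j M ^ 2 * (1 - 2 * x j M i)) t M := by
  induction t using Fin.induction with
  | zero => simp only [noise_zero, compensator_zero]; norm_num
  | succ j ih =>
    have drift_le : c j M ^ 2 * (x j M i * (1 - x j M i)) ≤ κ * (c j M * x j M i) := by
      have hx₀ := hx.nonneg j M i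
      calc c j M ^ 2 * (x j M i * (1 - x j M i))
          = c j M * (c j M * x j M i) - (c j M * x j M i) ^ 2 := by ring
        _ ≤ c j M * (c j M * x j M i) := sub_le_self _ (sq_nonneg _)
        _ ≤ κ * (c j M * x j M i) :=
          mul_le_mul_of_nonneg_right (hcκ j M) (mul_nonneg (hc₀ j M) hx₀)
    rw [noise_succ, compensator_succ, noise_succ]
    linear_combination ih + drift_le + c j M ^ 2 * X_sq M i j

theorem expectedReward_noise_sq_le (hx : IsStrategy x) (hc : IsPredictable c)
    (hc₀ : ∀ j M, 0 ≤ c j M) (hcκ : ∀ j M, c j M ≤ κ) (t : Fin (n + 1)) :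
    expectedReward x (fun M => noise x i c t M ^ 2) ≤
      κ * expectedReward x (realized i c t) := by
  have hpred : IsPredictable fun j M =>
      2 * noise x i c j.castSucc M * c j M - c j M ^ 2 * (1 - 2 * x j M i) := fun j M M' h => by
    simp only [isAdapted_noise hx.predictable hc j.castSucc h, hc j h, hx.predictable j h]
  refine (hx.expectedReward_mono fun M => noise_sq_le hx hc₀ hcκ t M).trans_eq ?_
  rw [expectedReward_add, expectedReward_const_mul, expectedReward_noise hx.predictable hpred,
    add_zero, expectedReward_compensator hx.predictable hc]

theorem abs_add_sign_mul_le (a b : ℝ) : |a| + SignType.sign a * b ≤ |a + b| := by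
  rcases lt_trichotomy a 0 with ha | rfl | ha
  · rw [abs_of_neg ha, sign_neg ha, SignType.coe_neg_one]
    linarith [neg_abs_le (a + b)]
  · simp
  · rw [abs_of_pos ha, sign_pos ha, SignType.coe_one, one_mul]
    exact le_abs_self _

-- A discrete Tanaka formula for `|N|`, integrated by parts against the realized sum of `d`.
theorem realized_mul_abs_noise_le {d : Fin n → Assignment L n → ℝ} (hx : IsStrategy x)
    (hc₀ : ∀ j M, 0 ≤ c j M) (hcκ : ∀ j M, c j M ≤ κ) (hd₀ : ∀ j M, 0 ≤ d j M)
    (t : Fin (n + 1)) (M : Assignment L n) :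
    realized i (fun j M => d j M * |noise x i c j.castSucc M|) t M ≤
      realized i d t M * (|noise x i c t M| + κ) - noise x i (fun j M =>
        realized i d j.castSucc M * SignType.sign (noise x i c j.castSucc M) * c j M) t M := by
  induction t using Fin.induction with
  | zero => simp only [realized_zero, noise_zero]; norm_num
  | succ j ih =>
    have abs_step_le : |c j M * (x j M i - X M i j)| ≤ κ := by
      rw [abs_mul, abs_of_nonneg (hc₀ j M)]
      refine (mul_le_of_le_one_right (hc₀ j M) ?_).trans (hcκ j M)
      exact abs_sub_le_of_nonneg_of_le (hx.nonneg j M i) (hx.le_one j M i) (X_nonneg M i j)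
        (X_le_one M i j)
    have abs_noise_le : |noise x i c j.castSucc M| ≤ |noise x i c j.succ M| + κ := by
      have := abs_sub_abs_le_abs_sub (noise x i c j.castSucc M) (noise x i c j.succ M)
      rw [abs_sub_comm, noise_succ, add_sub_cancel_left] at this
      rw [noise_succ]
      linarith
    have tanaka : |noise x i c j.castSucc M| + SignType.sign (noise x i c j.castSucc M) *
        (c j M * (x j M i - X M i j)) ≤ |noise x i c j.succ M| := by
      rw [noise_succ]
      exact abs_add_sign_mul_le _ _
    have old_level := mul_le_mul_of_nonneg_left tanaka (realized_nonneg hd₀ j.castSucc M (i := i))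
    have new_level :=
      mul_le_mul_of_nonneg_left abs_noise_le (mul_nonneg (hd₀ j M) (X_nonneg M i j))
    rw [realized_succ, realized_succ i d, noise_succ x i fun j M => _ * _ * _]
    linear_combination ih + old_level + new_level

theorem expectedReward_compensator_mul_abs_noise_le {d : Fin n → Assignment L n → ℝ}
    (hx : IsStrategy x) (hc : IsPredictable c) (hd : IsPredictable d) (hc₀ : ∀ j M, 0 ≤ c j M)
    (hcκ : ∀ j M, c j M ≤ κ) (hd₀ : ∀ j M, 0 ≤ d j M) (t : Fin (n + 1)) :
    expectedReward x (compensator x i (fun j M => d j M * |noise x i c j.castSucc M|) t) ≤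
      expectedReward x (fun M => realized i d t M * |noise x i c t M|) +
        κ * expectedReward x (realized i d t) := by
  have hN := isAdapted_noise (i := i) hx.predictable hc
  have hweight : IsPredictable fun j M => d j M * |noise x i c j.castSucc M| :=
    fun j M M' h => by simp only [hN j.castSucc h, hd j h]
  have hpred : IsPredictable fun j M =>
      realized i d j.castSucc M * SignType.sign (noise x i c j.castSucc M) * c j M :=
    fun j M M' h => by
      simp only [hN j.castSucc h, isAdapted_realized hd j.castSucc h, hc j h]
  rw [expectedReward_compensator hx.predictable hweight]
  refine (hx.expectedReward_mono fun M =>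
    realized_mul_abs_noise_le hx hc₀ hcκ hd₀ t M).trans_eq ?_
  rw [expectedReward_sub, expectedReward_noise hx.predictable hpred, sub_zero]
  simp only [mul_add, expectedReward_add, mul_comm _ κ, expectedReward_const_mul]

end Martingale

/-! ### The function `g` -/

theorem one_sub_inv_exp_pos : 0 < 1 - 1 / Real.exp 1 :=
  sub_pos.2 ((div_lt_one (Real.exp_pos 1)).2 (Real.one_lt_exp_iff.2 one_pos))

theorem g_pos (y : ℝ) : 0 < g y :=
  div_pos (Real.exp_pos _) one_sub_inv_exp_pos

theorem g_mono : Monotone g := fun _ _ h =>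
  div_le_div_of_nonneg_right (Real.exp_le_exp.2 (sub_le_sub_right h 1)) one_sub_inv_exp_pos.le

theorem g_one : g 1 = (1 - 1 / Real.exp 1)⁻¹ := by
  rw [g, sub_self, Real.exp_zero, one_div]

theorem g_one_le_two : g 1 ≤ 2 := by
  have two_le_exp : 2 ≤ Real.exp 1 := by linarith [Real.add_one_le_exp (1 : ℝ)]
  have := one_div_le_one_div_of_le two_pos two_le_exp
  rw [g_one]
  exact inv_le_of_inv_le₀ two_pos (by linarith)

theorem g_one_eq : g 1 = 1 + g 0 := by
  rw [g, g, sub_self, Real.exp_zero, zero_sub, Real.exp_neg, ← one_div (Real.exp 1),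
    div_eq_iff one_sub_inv_exp_pos.ne', add_mul, div_mul_cancel₀ _ one_sub_inv_exp_pos.ne']
  ring

theorem g_add (y d : ℝ) : g (y + d) = g y * Real.exp d := by
  rw [g, g, add_sub_right_comm, Real.exp_add, mul_div_right_comm]

theorem mul_g_le_sub (y d : ℝ) : d * g y ≤ g (y + d) - g y := by
  rw [g_add]
  have := mul_le_mul_of_nonneg_left (Real.add_one_le_exp d) (g_pos y).le
  linarith

theorem sub_le_mul_g (y d : ℝ) : g (y + d) - g y ≤ d * g (y + d) := by
  have h := mul_g_le_sub (y + d) (-d)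
  rw [add_neg_cancel_right] at h
  linarith

theorem g_sub_g_zero_le {y : ℝ} (hy₀ : 0 ≤ y) (hy₁ : y ≤ 1) : g y - g 0 ≤ y := by
  have chord := convexOn_exp.2 (Set.mem_univ (-1)) (Set.mem_univ 0) (sub_nonneg.2 hy₁) hy₀
    (sub_add_cancel 1 y)
  simp only [smul_eq_mul, mul_neg_one, mul_zero, add_zero, neg_sub, Real.exp_zero] at chord
  rw [g, g, zero_sub, ← sub_div, div_le_iff₀ one_sub_inv_exp_pos, one_div, ← Real.exp_neg]
  linarith

/-! ### The level of one offline vertex -/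

section Level

theorem abs_le_half_add_sq_div {θ : ℝ} (hθ : 0 < θ) (a : ℝ) : |a| ≤ θ / 2 + a ^ 2 / (2 * θ) := by
  have h : 0 ≤ (|a| - θ) ^ 2 / (2 * θ) := by positivity
  calc |a| ≤ |a| + (|a| - θ) ^ 2 / (2 * θ) := le_add_of_nonneg_right h
    _ = θ / 2 + a ^ 2 / (2 * θ) := by rw [← sq_abs a]; field_simp; ring

variable {L : Type*} [DecidableEq L] {n : ℕ}

/-- The increase of `g` of the level of `i` if `j` is assigned to `i`, where assigning `k` to `i`
raises the level by `d k`. -/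
def jump (i : L) (d : Fin n → Assignment L n → ℝ) (j : Fin n) (M : Assignment L n) : ℝ :=
  g (realized i d j.castSucc M + d j M) - g (realized i d j.castSucc M)

theorem g_realized_sub_g_zero (i : L) (d : Fin n → Assignment L n → ℝ) (t : Fin (n + 1))
    (M : Assignment L n) : g (realized i d t M) - g 0 = realized i (jump i d) t M := by
  induction t using Fin.induction with
  | zero => simp only [realized_zero, sub_self]
  | succ j ih =>
    rw [realized_succ, realized_succ, ← ih]
    rcases X_eq_zero_or_one M i j with h | h <;> simp [h, jump]

/-- The increments `d` of the level of `i` are predictable, at most `δ`, and never lift the level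
above `1`. -/
structure IsSmallIncrement (i : L) (d : Fin n → Assignment L n → ℝ) (δ : ℝ) : Prop where
  predictable : IsPredictable d
  nonneg : ∀ j M, 0 ≤ d j M
  le : ∀ j M, d j M ≤ δ
  realized_add_le : ∀ j M, realized i d j.castSucc M + d j M ≤ 1

namespace IsSmallIncrement

variable {i : L} {d : Fin n → Assignment L n → ℝ} {δ : ℝ}

theorem realized_nonneg (hd : IsSmallIncrement i d δ) (t : Fin (n + 1)) (M : Assignment L n) :
    0 ≤ realized i d t M :=
  OnlineMatching.realized_nonneg hd.nonneg t M

theorem realized_le_one (hd : IsSmallIncrement i d δ) (t : Fin (n + 1)) (M : Assignment L n) :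
    realized i d t M ≤ 1 := by
  cases t using Fin.cases with
  | zero => exact (realized_zero i d M).trans_le zero_le_one
  | succ j =>
    rw [realized_succ]
    have := mul_le_of_le_one_right (hd.nonneg j M) (X_le_one M i j)
    linarith [hd.realized_add_le j M]

theorem isPredictable_jump (hd : IsSmallIncrement i d δ) : IsPredictable (jump i d) :=
  fun j M M' h => by
    simp only [jump, hd.predictable j h, isAdapted_realized hd.predictable j.castSucc h]

theorem jump_nonneg (hd : IsSmallIncrement i d δ) (j : Fin n) (M : Assignment L n) :
    0 ≤ jump i d j M :=
  sub_nonneg.2 (g_mono (le_add_of_nonneg_right (hd.nonneg j M)))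

theorem jump_le (hd : IsSmallIncrement i d δ) (j : Fin n) (M : Assignment L n) :
    jump i d j M ≤ 2 * δ :=
  calc jump i d j M ≤ d j M * g (realized i d j.castSucc M + d j M) := sub_le_mul_g _ _
    _ ≤ δ * 2 := mul_le_mul (hd.le j M) ((g_mono (hd.realized_add_le j M)).trans g_one_le_two)
        (g_pos _).le ((hd.nonneg j M).trans (hd.le j M))
    _ = 2 * δ := mul_comm _ _

theorem one_sub_mul_jump_le (hd : IsSmallIncrement i d δ) (j : Fin n) (M : Assignment L n) :
    (1 - δ) * jump i d j M ≤ d j M * g (realized i d j.castSucc M) := by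
  have h := sub_le_mul_g (realized i d j.castSucc M) (d j M)
  have := mul_le_mul_of_nonneg_right (hd.le j M) (hd.jump_nonneg j M)
  simp only [jump] at this ⊢
  linarith

theorem realized_jump_le (hd : IsSmallIncrement i d δ) (t : Fin (n + 1)) (M : Assignment L n) :
    realized i (jump i d) t M ≤ realized i d t M := by
  rw [← g_realized_sub_g_zero]
  exact g_sub_g_zero_le (hd.realized_nonneg t M) (hd.realized_le_one t M)

theorem realized_jump_le_one (hd : IsSmallIncrement i d δ) (t : Fin (n + 1))
    (M : Assignment L n) : realized i (jump i d) t M ≤ 1 :=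
  (hd.realized_jump_le t M).trans (hd.realized_le_one t M)

variable {x : Fin n → Assignment L n → L → ℝ}

theorem max_one_sub_le (hd : IsSmallIncrement i d δ) (hδ₀ : 0 ≤ δ) (hδ₁ : δ ≤ 1)
    {t : Fin (n + 1)} {M : Assignment L n} {b : ℝ}
    (hb : (1 - δ) * compensator x i (jump i d) t M ≤ b) :
    max 0 (1 - b) ≤ 1 - realized i (jump i d) t M + δ + |noise x i (jump i d) t M| := by
  have realized_le := hd.realized_jump_le_one t M
  refine max_le (by linarith [abs_nonneg (noise x i (jump i d) t M)]) ?_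
  have predicted_eq : compensator x i (jump i d) t M =
      realized i (jump i d) t M + noise x i (jump i d) t M := (add_sub_cancel _ _).symm
  rw [predicted_eq] at hb
  have := mul_le_mul_of_nonneg_left realized_le hδ₀
  have := mul_le_mul_of_nonneg_left (neg_abs_le (noise x i (jump i d) t M)) (sub_nonneg.2 hδ₁)
  have := mul_nonneg hδ₀ (abs_nonneg (noise x i (jump i d) t M))
  linarith

theorem mul_max_one_sub_le (hd : IsSmallIncrement i d δ) (hδ₀ : 0 ≤ δ) (hδ₁ : δ ≤ 1) {j : Fin n}
    {M : Assignment L n} {b : ℝ} (hb : (1 - δ) * compensator x i (jump i d) j.castSucc M ≤ b) :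
    d j M * max 0 (1 - b) ≤ (g 1 + δ) * d j M - (1 - δ) * jump i d j M +
      d j M * |noise x i (jump i d) j.castSucc M| := by
  have bound := mul_le_mul_of_nonneg_left (hd.max_one_sub_le hδ₀ hδ₁ hb) (hd.nonneg j M)
  rw [← g_realized_sub_g_zero] at bound
  rw [g_one_eq]
  linarith [hd.one_sub_mul_jump_le j M]

variable [Fintype L]

theorem expectedReward_realized_nonneg (hd : IsSmallIncrement i d δ) (hx : IsStrategy x)
    (t : Fin (n + 1)) : 0 ≤ expectedReward x (realized i d t) :=
  (expectedReward_const hx.predictable 0).symm.trans_le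
    (hx.expectedReward_mono (hd.realized_nonneg t))

theorem expectedReward_realized_le_one (hd : IsSmallIncrement i d δ) (hx : IsStrategy x)
    (t : Fin (n + 1)) : expectedReward x (realized i d t) ≤ 1 :=
  (hx.expectedReward_mono (hd.realized_le_one t)).trans_eq (expectedReward_const hx.predictable 1)

variable {θ : ℝ}

theorem expectedReward_noise_sq_div_le (hθ : 0 < θ) (hd : IsSmallIncrement i d (θ ^ 2))
    (hx : IsStrategy x) (t : Fin (n + 1)) :
    expectedReward x (fun M => noise x i (jump i d) t M ^ 2 / (2 * θ)) ≤
      θ * expectedReward x (realized i d t) := by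
  have noise_sq_le : expectedReward x (fun M => noise x i (jump i d) t M ^ 2) ≤
      2 * θ ^ 2 * expectedReward x (realized i d t) :=
    (OnlineMatching.expectedReward_noise_sq_le hx hd.isPredictable_jump hd.jump_nonneg
      hd.jump_le t).trans (mul_le_mul_of_nonneg_left
        (hx.expectedReward_mono (hd.realized_jump_le t)) (by positivity))
  simp only [div_eq_inv_mul _ (2 * θ), expectedReward_const_mul]
  rw [inv_mul_le_iff₀ (by positivity)]
  linarith

theorem expectedReward_abs_noise_le (hθ : 0 < θ) (hd : IsSmallIncrement i d (θ ^ 2))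
    (hx : IsStrategy x) (t : Fin (n + 1)) :
    expectedReward x (fun M => |noise x i (jump i d) t M|) ≤ 3 / 2 * θ := by
  have := mul_le_mul_of_nonneg_left (hd.expectedReward_realized_le_one hx t) hθ.le
  calc expectedReward x (fun M => |noise x i (jump i d) t M|)
      ≤ expectedReward x (fun M => θ / 2 + noise x i (jump i d) t M ^ 2 / (2 * θ)) :=
        hx.expectedReward_mono fun M => abs_le_half_add_sq_div hθ _
    _ ≤ θ / 2 + θ * expectedReward x (realized i d t) := by
        rw [expectedReward_add, expectedReward_const hx.predictable]
        exact add_le_add_right (hd.expectedReward_noise_sq_div_le hθ hx t) _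
    _ ≤ 3 / 2 * θ := by linarith

theorem expectedReward_compensator_mul_abs_noise_le (hθ₀ : 0 < θ) (hθ₁ : θ ≤ 1 / 2)
    (hd : IsSmallIncrement i d (θ ^ 2)) (hx : IsStrategy x) (t : Fin (n + 1)) :
    expectedReward x
        (compensator x i (fun j M => d j M * |noise x i (jump i d) j.castSucc M|) t) ≤
      5 / 2 * θ * expectedReward x (realized i d t) := by
  have hEY := hd.expectedReward_realized_nonneg hx t
  have weighted : expectedReward x (fun M => realized i d t M * |noise x i (jump i d) t M|) ≤
      3 / 2 * θ * expectedReward x (realized i d t) :=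
    calc expectedReward x (fun M => realized i d t M * |noise x i (jump i d) t M|)
        ≤ expectedReward x (fun M =>
            θ / 2 * realized i d t M + noise x i (jump i d) t M ^ 2 / (2 * θ)) :=
          hx.expectedReward_mono fun M => by
            have hsq : 0 ≤ noise x i (jump i d) t M ^ 2 / (2 * θ) := by positivity
            have := mul_le_mul_of_nonneg_left (abs_le_half_add_sq_div hθ₀
              (noise x i (jump i d) t M)) (hd.realized_nonneg t M)
            have := mul_le_of_le_one_left hsq (hd.realized_le_one t M)
            linarith
      _ ≤ θ / 2 * expectedReward x (realized i d t) + θ * expectedReward x (realized i d t) := by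
          rw [expectedReward_add, expectedReward_const_mul]
          exact add_le_add_right (hd.expectedReward_noise_sq_div_le hθ₀ hx t) _
      _ = 3 / 2 * θ * expectedReward x (realized i d t) := by ring
  have tanaka := OnlineMatching.expectedReward_compensator_mul_abs_noise_le hx
    hd.isPredictable_jump hd.predictable hd.jump_nonneg hd.jump_le hd.nonneg t (i := i)
  have : θ ^ 2 * expectedReward x (realized i d t) ≤
      θ / 2 * expectedReward x (realized i d t) :=
    mul_le_mul_of_nonneg_right (by nlinarith) hEY
  linarith

theorem compensator_mul_max_one_sub_le (hd : IsSmallIncrement i d δ) (hδ₀ : 0 ≤ δ) (hδ₁ : δ ≤ 1)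
    (hx : IsStrategy x) {b : Fin (n + 1) → Assignment L n → ℝ}
    (hb : ∀ t M, (1 - δ) * compensator x i (jump i d) t M ≤ b t M) (t : Fin (n + 1))
    (M : Assignment L n) :
    compensator x i (fun j M => d j M * max 0 (1 - b j.castSucc M)) t M ≤
      (g 1 + δ) * compensator x i d t M - (1 - δ) * compensator x i (jump i d) t M +
        compensator x i (fun j M => d j M * |noise x i (jump i d) j.castSucc M|) t M := by
  induction t using Fin.induction with
  | zero => simp only [compensator_zero]; norm_num
  | succ j ih =>
    have := mul_le_mul_of_nonneg_right (hd.mul_max_one_sub_le hδ₀ hδ₁ (hb j.castSucc M))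
      (hx.nonneg j M i)
    simp only [compensator_succ]
    linarith

theorem expectedReward_dual_le (hθ₀ : 0 < θ) (hθ₁ : θ ≤ 1 / 2) (hd : IsSmallIncrement i d (θ ^ 2))
    (hx : IsStrategy x) {b : Fin (n + 1) → Assignment L n → ℝ}
    (hlow : ∀ t M, (1 - θ ^ 2) * compensator x i (jump i d) t M ≤ b t M)
    (hup : ∀ t M, b t M ≤ (1 + θ ^ 2) * compensator x i (jump i d) t M) (t : Fin (n + 1)) :
    expectedReward x (compensator x i (fun j M => d j M * max 0 (1 - b j.castSucc M)) t) +
        expectedReward x (b t) ≤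
      (g 1 + 4 * θ) * expectedReward x (realized i d t) := by
  have hθ_sq : θ ^ 2 ≤ θ / 2 := by nlinarith
  have arrivals_le := hx.expectedReward_mono
    (hd.compensator_mul_max_one_sub_le (sq_nonneg θ) (by linarith) hx hlow t)
  have vertex_le := hx.expectedReward_mono (hup t)
  rw [expectedReward_add, expectedReward_sub, expectedReward_const_mul, expectedReward_const_mul,
    expectedReward_compensator hx.predictable hd.predictable] at arrivals_le
  rw [expectedReward_const_mul] at vertex_le
  rw [expectedReward_compensator hx.predictable hd.isPredictable_jump] at arrivals_le vertex_le
  have noise_le := hd.expectedReward_compensator_mul_abs_noise_le hθ₀ hθ₁ hx t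
  have := mul_le_mul_of_nonneg_left (hx.expectedReward_mono (hd.realized_jump_le t)) (sq_nonneg θ)
  have := mul_le_mul_of_nonneg_right hθ_sq (hd.expectedReward_realized_nonneg hx t)
  linarith

end IsSmallIncrement

end Level

/-! ### Water filling -/

section WaterFilling

open Filter

/-- `φ` is a continuous inverse of `f : [0, ∞) → ℝ` along the levels `ψ`: at time `u`, the argument
`φ u` has been raised from `0` just far enough to bring `f` down to the level `ψ u`. Time runs
backwards, so that a decreasing level makes `φ` antitone. -/
structure IsFillCurve (f φ ψ : ℝ → ℝ) : Prop where
  continuous : Continuous φ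
  antitone : Antitone φ
  nonneg : ∀ u, 0 ≤ φ u
  apply_le : ∀ u, f (φ u) ≤ ψ u
  apply_eq : ∀ u, 0 < φ u → f (φ u) = ψ u
  eventually_eq_zero : ∀ᶠ u in atTop, φ u = 0

theorem IsFillCurve.comp {f φ ψ p : ℝ → ℝ} (h : IsFillCurve f φ ψ) (hc : Continuous p)
    (hm : Monotone p) (ht : Tendsto p atTop atTop) : IsFillCurve f (φ ∘ p) (ψ ∘ p) where
  continuous := h.continuous.comp hc
  antitone := h.antitone.comp_monotone hm
  nonneg u := h.nonneg (p u)
  apply_le u := h.apply_le (p u)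
  apply_eq u := h.apply_eq (p u)
  eventually_eq_zero := ht.eventually h.eventually_eq_zero

theorem isFillCurve_zero : IsFillCurve 0 (fun u => max (-u) 0) (fun u => max u 0) where
  continuous := by fun_prop
  antitone _ _ h := max_le_max (neg_le_neg h) le_rfl
  nonneg _ := le_max_right _ _
  apply_le _ := le_max_right _ _
  apply_eq u hu := by
    have u_neg : u < 0 := by simpa using hu
    exact (max_eq_right u_neg.le).symm
  eventually_eq_zero := by
    filter_upwards [eventually_ge_atTop (0 : ℝ)] with u hu
    exact max_eq_right (neg_nonpos.2 hu)

theorem exists_leftInverse_of_strictAntiOn {f : ℝ → ℝ} (ha : StrictAntiOn f (Set.Ici 0))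
    (hc : Continuous f) (hl : Tendsto f atTop atBot) :
    ∃ h : ℝ → ℝ, Continuous h ∧ Antitone h ∧ (∀ l, 0 ≤ h l) ∧ (∀ s, 0 ≤ s → h (f s) = s) ∧
      ∀ l, f (h l) = min l (f 0) := by
  -- `-f` continued to the negative half-line with slope `1` is an order isomorphism of `ℝ`.
  set F : ℝ → ℝ := fun s => -f (max s 0) + min s 0 with hF
  have F_of_nonneg : ∀ s, 0 ≤ s → F s = -f s := fun s hs => by
    simp only [hF, max_eq_left hs, min_eq_right hs, add_zero]
  have F_of_nonpos : ∀ s, s ≤ 0 → F s = -f 0 + s := fun s hs => by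
    simp only [hF, max_eq_right hs, min_eq_left hs]
  have F_strictMono : StrictMono F := by
    refine StrictMonoOn.Iic_union_Ici (a := 0) (fun s hs t ht hst => ?_) fun s hs t ht hst => ?_
    · rw [F_of_nonpos s hs, F_of_nonpos t ht]
      gcongr
    · rw [F_of_nonneg s hs, F_of_nonneg t ht]
      exact neg_lt_neg (ha hs ht hst)
  have F_top : Tendsto F atTop atTop := by
    refine (tendsto_neg_atBot_atTop.comp hl).congr' ?_
    filter_upwards [eventually_ge_atTop (0 : ℝ)] with s hs using (F_of_nonneg s hs).symm
  have F_bot : Tendsto F atBot atBot := by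
    refine (tendsto_atBot_add_const_left atBot (-f 0) tendsto_id).congr' ?_
    filter_upwards [eventually_le_atBot (0 : ℝ)] with s hs using (F_of_nonpos s hs).symm
  have F_continuous : Continuous F := by fun_prop
  let e : ℝ ≃o ℝ := F_strictMono.orderIsoOfSurjective F (F_continuous.surjective F_top F_bot)
  refine ⟨fun l => max (e.symm (-l)) 0, (e.symm.continuous.comp continuous_neg).max
    continuous_const, fun a b hab => max_le_max (e.symm.monotone (neg_le_neg hab)) le_rfl,
    fun l => le_max_right _ _, fun s hs => ?_, fun l => ?_⟩
  · dsimp only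
    rw [← F_of_nonneg s hs, show F s = e s from rfl, e.symm_apply_apply, max_eq_left hs]
  · dsimp only
    have F_symm : F (e.symm (-l)) = -l := e.apply_symm_apply _
    rcases le_total 0 (e.symm (-l)) with hs | hs
    · rw [F_of_nonneg _ hs] at F_symm
      have := ha.antitoneOn Set.self_mem_Ici hs hs
      rw [max_eq_left hs, min_eq_left] <;> linarith
    · rw [F_of_nonpos _ hs] at F_symm
      rw [max_eq_right hs, min_eq_right]
      linarith

theorem exists_isFillCurve_id {f : ℝ → ℝ} (ha : StrictAntiOn f (Set.Ici 0)) (hc : Continuous f)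
    (hl : Tendsto f atTop atBot) : ∃ φ, IsFillCurve f φ id ∧ ∃ u, φ u = 1 := by
  obtain ⟨h, h_cont, h_anti, h_nonneg, h_left, h_right⟩ :=
    exists_leftInverse_of_strictAntiOn ha hc hl
  have h_eq_zero : ∀ l, f 0 ≤ l → h l = 0 := fun l hl =>
    le_antisymm ((h_anti hl).trans (h_left 0 le_rfl).le) (h_nonneg l)
  refine ⟨h, ⟨h_cont, h_anti, h_nonneg, fun u => (h_right u).trans_le (min_le_left _ _),
    fun u hu => ?_, eventually_ge_atTop (f 0) |>.mono h_eq_zero⟩, f 1, h_left 1 zero_le_one⟩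
  have lt_top : u < f 0 := lt_of_not_ge fun hle => hu.ne' (h_eq_zero u hle)
  exact (h_right u).trans (min_eq_left lt_top.le)

variable {L : Type*} {f : L → ℝ → ℝ}

theorem exists_fillCurves [Nonempty L] (hf : ∀ i, f i = 0 ∨
      (StrictAntiOn (f i) (Set.Ici 0) ∧ Continuous (f i) ∧ Tendsto (f i) atTop atBot)) :
    ∃ (φ : L → ℝ → ℝ) (ψ : ℝ → ℝ), (∀ i, IsFillCurve (f i) (φ i) ψ) ∧ ∃ i u, 1 ≤ φ i u := by
  classical
  have of_ne_zero : ∀ i, ∃ φ, f i ≠ 0 → IsFillCurve (f i) φ id ∧ ∃ u, φ u = 1 := by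
    intro i
    rcases hf i with h0 | ⟨ha, hc, hl⟩
    · exact ⟨0, fun h => absurd h0 h⟩
    · exact (exists_isFillCurve_id ha hc hl).imp fun φ hφ _ => hφ
  choose φ hφ using of_ne_zero
  by_cases hex : ∃ z, f z = 0
  -- A vanishing `f z` absorbs everything at level `0`, so the other curves stop there.
  · obtain ⟨z, hz⟩ := hex
    refine ⟨fun i => if f i = 0 then fun u => max (-u) 0 else φ i ∘ fun u => max u 0,
      fun u => max u 0, fun i => ?_, z, -1, by simp [hz]⟩
    dsimp only
    split_ifs with hi
    · rw [hi]
      exact isFillCurve_zero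
    · exact (hφ i hi).1.comp (by fun_prop) (fun a b h => max_le_max h le_rfl)
        (tendsto_atTop_mono (fun u => le_max_left u 0) tendsto_id)
  · push Not at hex
    obtain ⟨i⟩ := ‹Nonempty L›
    obtain ⟨u, hu⟩ := (hφ i (hex i)).2
    exact ⟨φ, id, fun k => (hφ k (hex k)).1, i, u, hu.ge⟩

variable [Fintype L]

theorem IsFillCurve.le_of_sum_le {φ : L → ℝ → ℝ} {ψ : ℝ → ℝ}
    (hφ : ∀ i, IsFillCurve (f i) (φ i) ψ) {a b : ℝ} (hab : ∑ i, φ i a ≤ ∑ i, φ i b) (i : L) :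
    φ i a ≤ φ i b := by
  rcases le_total b a with hba | hab'
  · exact (hφ i).antitone hba
  · have coord_le : ∀ k ∈ (univ : Finset L), φ k b ≤ φ k a := fun k _ => (hφ k).antitone hab'
    have sums_eq := le_antisymm (sum_le_sum coord_le) hab
    exact ((sum_eq_sum_iff_of_le coord_le).1 sums_eq i (mem_univ i)).ge

theorem exists_waterFilling [Nonempty L] (hf : ∀ i, f i = 0 ∨
      (StrictAntiOn (f i) (Set.Ici 0) ∧ Continuous (f i) ∧ Tendsto (f i) atTop atBot)) :
    ∃ ξ : ℝ → L → ℝ, (∀ t i, 0 ≤ ξ t i) ∧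
      (∀ i, MonotoneOn (fun t => ξ t i) (Set.Icc 0 1)) ∧
      (∀ t ∈ Set.Icc (0 : ℝ) 1, ∑ i, ξ t i = t) ∧
      ∀ t i, 0 < ξ t i → ∀ k, f k (ξ t k) ≤ f i (ξ t i) := by
  obtain ⟨φ, ψ, hφ, i₀, u₀, hu₀⟩ := exists_fillCurves hf
  have sum_continuous : Continuous fun u => ∑ i, φ i u :=
    continuous_finsetSum _ fun i _ => (hφ i).continuous
  obtain ⟨u₁, hu₁⟩ := (eventually_all.2 fun i => (hφ i).eventually_eq_zero).exists
  have exists_time : ∀ t : ℝ, ∃ u, t ∈ Set.Icc (0 : ℝ) 1 → ∑ i, φ i u = t := by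
    intro t
    by_cases ht : t ∈ Set.Icc (0 : ℝ) 1
    · obtain ⟨u, hu⟩ := mem_range_of_exists_le_of_exists_ge sum_continuous
        ⟨u₁, (sum_eq_zero fun i _ => hu₁ i).trans_le ht.1⟩
        ⟨u₀, ht.2.trans (hu₀.trans
          (single_le_sum (f := fun i => φ i u₀) (fun i _ => (hφ i).nonneg u₀) (mem_univ i₀)))⟩
      exact ⟨u, fun _ => hu⟩
    · exact ⟨0, fun h => absurd h ht⟩
  choose u hu using exists_time
  refine ⟨fun t i => φ i (u t), fun t i => (hφ i).nonneg _, fun i s hs t ht hst => ?_, hu,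
    fun t i hpos k => ?_⟩
  · refine IsFillCurve.le_of_sum_le hφ ?_ i
    rwa [hu s hs, hu t ht]
  · exact ((hφ k).apply_le _).trans ((hφ i).apply_eq _ hpos).ge

end WaterFilling

namespace BudgetInstance

variable {L : Type*} [DecidableEq L] {n : ℕ} (I : BudgetInstance L n)

/-! ### Dependence on the past -/

section Congruence

variable {I} {x x' : Fin n → Assignment L n → L → ℝ} {E E' : Assignment L n} {j : Fin n}

theorem load_congr (hE : ∀ k < j, E k = E' k) (i : L) : I.load E j i = I.load E' j i :=
  sum_congr rfl fun k hk => by simp only [X, hE k (mem_Iio.1 hk)]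

theorem gain_congr (hE : ∀ k < j, E k = E' k) (i : L) : I.gain E j i = I.gain E' j i := by
  simp only [gain, load_congr hE]

theorem Y_congr (hE : ∀ k < j, E k = E' k) (i : L) : I.Y E j i = I.Y E' j i :=
  sum_congr rfl fun k hk => by
    have hk := mem_Iio.1 hk
    simp only [X, hE k hk, gain_congr fun l hl => hE l (hl.trans hk)]

theorem increaseB_congr (hE : ∀ k < j, E k = E' k) (i : L) (r s : ℝ) :
    I.increaseB E j i r s = I.increaseB E' j i r s := by
  simp only [increaseB, gain_congr hE, Y_congr hE]

theorem B_congr (hE : ∀ k < j, E k = E' k) (hx : ∀ k < j, x k E = x' k E') (i : L) :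
    I.B x E j i = I.B x' E' j i :=
  sum_congr rfl fun k hk => by
    have hk := mem_Iio.1 hk
    simp only [X, hE k hk, increaseB_congr fun l hl => hE l (hl.trans hk), hx k hk]

theorem score_congr (hE : ∀ k < j, E k = E' k) (hx : ∀ k < j, x k E = x' k E') :
    I.score x E j = I.score x' E' j := by
  funext ξ i
  simp only [score, gain_congr hE, B_congr hE hx, increaseB_congr hE]

theorem IsLoop.congr [Fintype L] {ξ : ℝ → L → ℝ} (hE : ∀ k < j, E k = E' k)
    (hx : ∀ k < j, x k E = x' k E') (hξ : I.IsLoop x E j ξ) : I.IsLoop x' E' j ξ :=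
  ⟨hξ.start, hξ.mono, hξ.total, by simpa only [score_congr hE hx] using hξ.greedy⟩

end Congruence

/-! ### Existence of a run -/

theorem gain_nonneg (E : Assignment L n) (j : Fin n) (i : L) : 0 ≤ I.gain E j i :=
  le_min (I.weight_nonneg i j) (le_max_left _ _)

theorem gain_div_budget_nonneg (E : Assignment L n) (j : Fin n) (i : L) :
    0 ≤ I.gain E j i / I.budget i :=
  div_nonneg (I.gain_nonneg E j i) (I.budget_pos i).le

theorem g_Y_le_g_Y_add (E : Assignment L n) (j : Fin n) (i : L) :
    g (I.Y E j i) ≤ g (I.Y E j i + I.gain E j i / I.budget i) :=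
  g_mono (le_add_of_nonneg_right (I.gain_div_budget_nonneg E j i))

theorem increaseB_eq (E : Assignment L n) (j : Fin n) (i : L) (r s : ℝ) :
    I.increaseB E j i r s = I.gain E j i * (s * g (I.Y E j i) + r * s ^ 2 / 2 *
      (g (I.Y E j i + I.gain E j i / I.budget i) - g (I.Y E j i))) := by
  rw [increaseB, intervalIntegral.integral_const_mul]
  congr 1
  generalize g (I.Y E j i + I.gain E j i / I.budget i) = b
  generalize g (I.Y E j i) = a
  have integrand_eq : ∀ t : ℝ, (1 - r * t) * a + r * t * b = a + r * (b - a) * t :=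
    fun t => by ring
  simp only [integrand_eq]
  rw [intervalIntegral.integral_add (continuous_const.intervalIntegrable _ _)
      (Continuous.intervalIntegrable (by fun_prop) _ _),
    intervalIntegral.integral_const_mul, integral_id, intervalIntegral.integral_const, smul_eq_mul]
  ring

theorem increaseB_one_mono (E : Assignment L n) (j : Fin n) (i : L) :
    MonotoneOn (I.increaseB E j i 1) (Set.Ici 0) := by
  intro s (hs : 0 ≤ s) t _ hst
  have g_nonneg := (g_pos (I.Y E j i)).le
  have g_increase_nonneg := sub_nonneg.2 (I.g_Y_le_g_Y_add E j i)
  have gain_nonneg := I.gain_nonneg E j i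
  rw [increaseB_eq, increaseB_eq]
  gcongr

open Filter in
theorem strictAntiOn_continuous_tendsto_quadratic (c : ℝ) {a b : ℝ} (ha : 0 < a) (hb : 0 ≤ b) :
    StrictAntiOn (fun s : ℝ => c - (a * s + b * s ^ 2)) (Set.Ici 0) ∧
      Continuous (fun s : ℝ => c - (a * s + b * s ^ 2)) ∧
      Tendsto (fun s : ℝ => c - (a * s + b * s ^ 2)) atTop atBot := by
  refine ⟨fun s (hs : 0 ≤ s) t _ hst => ?_, by fun_prop, ?_⟩
  · dsimp only
    have linear_lt : a * s < a * t := by gcongr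
    have quadratic_le : b * s ^ 2 ≤ b * t ^ 2 := by gcongr
    linarith
  · refine tendsto_atBot_mono (fun s => ?_) (tendsto_atBot_add_const_left atTop c
      (tendsto_id.const_mul_atTop_of_neg (neg_neg_of_pos ha)))
    have : 0 ≤ b * s ^ 2 := by positivity
    simp only [id_eq]
    linarith

open Filter in
theorem score_eq_zero_or_strictAntiOn (x : Fin n → Assignment L n → L → ℝ) (E : Assignment L n)
    (j : Fin n) (i : L) :
    (fun s => I.score x E j (fun _ => s) i) = 0 ∨
      (StrictAntiOn (fun s => I.score x E j (fun _ => s) i) (Set.Ici 0) ∧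
        Continuous (fun s => I.score x E j (fun _ => s) i) ∧
        Tendsto (fun s => I.score x E j (fun _ => s) i) atTop atBot) := by
  rcases (I.gain_nonneg E j i).eq_or_lt with gain_zero | gain_pos
  · left
    funext s
    simp [score, ← gain_zero]
  right
  have budget_pos := I.budget_pos i
  have g_pos := g_pos (I.Y E j i)
  have g_increase_nonneg := sub_nonneg.2 (I.g_Y_le_g_Y_add E j i)
  have score_eq : (fun s => I.score x E j (fun _ => s) i) = fun s =>
      I.gain E j i * (1 - I.B x E j i / I.budget i) -
        (I.gain E j i ^ 2 / I.budget i * g (I.Y E j i) * s + I.gain E j i ^ 2 / I.budget i *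
          (g (I.Y E j i + I.gain E j i / I.budget i) - g (I.Y E j i)) / 2 * s ^ 2) := by
    funext s
    rw [score, increaseB_eq]
    field_simp
    ring
  rw [score_eq]
  exact strictAntiOn_continuous_tendsto_quadratic _ (by positivity) (by positivity)

section Existence

variable [Fintype L]

theorem exists_isLoop [Nonempty L] (x : Fin n → Assignment L n → L → ℝ) (E : Assignment L n)
    (j : Fin n) : ∃ ξ, I.IsLoop x E j ξ := by
  obtain ⟨ξ, nonneg, mono, total, max_of_pos⟩ :=
    exists_waterFilling (I.score_eq_zero_or_strictAntiOn x E j)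
  refine ⟨ξ, fun i => ?_, mono, total, fun i s _ t _ hst hlt => ?_⟩
  · exact (sum_eq_zero_iff_of_nonneg fun i _ => nonneg 0 i).1 (total 0 (by simp)) i (mem_univ i)
  · exact ⟨t, Set.right_mem_Icc.2 hst.le, max_of_pos t i ((nonneg s i).trans_lt hlt)⟩

/-- `v` is a vector of final fractions that the algorithm may choose at the arrival of `j`, when the
earlier vertices were assigned as in `E` and received the fractions `x`. -/
def IsStep (x : Fin n → Assignment L n → L → ℝ) (E : Assignment L n) (j : Fin n) (v : L → ℝ) :
    Prop :=
  ((∀ i, 1 ≤ I.Y E j i) → ∀ i, v i = 0) ∧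
    ((∃ i, I.Y E j i < 1) → ∃ ξ : ℝ → L → ℝ, I.IsLoop x E j ξ ∧ v = ξ 1)

theorem IsStep.congr {I : BudgetInstance L n} {x x' : Fin n → Assignment L n → L → ℝ}
    {E E' : Assignment L n} {j : Fin n} {v : L → ℝ} (hE : ∀ k < j, E k = E' k)
    (hx : ∀ k < j, x k E = x' k E') (hv : I.IsStep x E j v) : I.IsStep x' E' j v := by
  simp only [IsStep, Y_congr hE] at hv ⊢
  exact ⟨hv.1, fun h => (hv.2 h).imp fun ξ hξ => ⟨hξ.1.congr hE hx, hξ.2⟩⟩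

theorem exists_isStep (x : Fin n → Assignment L n → L → ℝ) (E : Assignment L n) (j : Fin n) :
    ∃ v, I.IsStep x E j v := by
  by_cases hE : ∃ i, I.Y E j i < 1
  · have : Nonempty L := ⟨hE.choose⟩
    obtain ⟨ξ, hξ⟩ := I.exists_isLoop x E j
    exact ⟨ξ 1, fun h => absurd hE (by simpa only [not_exists, not_lt] using h),
      fun _ => ⟨ξ, hξ, rfl⟩⟩
  · exact ⟨0, fun _ _ => rfl, fun h => absurd h hE⟩

/-- The assignment `E` forgotten from the arrival of `j` on. -/
def truncate (E : Assignment L n) (j : Fin n) : Assignment L n :=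
  fun k => if k < j then E k else none

/-- A run of the algorithm that chooses an arbitrary admissible step at each arrival. The step is
chosen at the truncated assignment, so that it cannot read the future. -/
def run (j : Fin n) (E : Assignment L n) : L → ℝ :=
  (I.exists_isStep (fun k E' => if _ : k < j then run k E' else 0) (truncate E j) j).choose
termination_by j

theorem run_congr {E E' : Assignment L n} {j : Fin n} (hE : ∀ k < j, E k = E' k) :
    I.run j E = I.run j E' := by
  have truncate_eq : truncate E j = truncate E' j :=
    funext fun k => ite_congr rfl (hE k) fun _ => rfl
  rw [run, run]
  simp only [truncate_eq]

theorem isStep_run (E : Assignment L n) (j : Fin n) : I.IsStep I.run E j (I.run j E) := by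
  have truncate_eq : ∀ k < j, truncate E j k = E k := fun k hk => if_pos hk
  rw [run]
  refine (I.exists_isStep _ _ _).choose_spec.congr truncate_eq fun k hk => ?_
  rw [dif_pos hk]
  exact I.run_congr fun l hl => truncate_eq l (hl.trans hk)

theorem isRun_run : I.IsRun I.run where
  adapted _ _ _ hE := I.run_congr hE
  idle j E := (I.isStep_run E j).1
  loop j E := (I.isStep_run E j).2

end Existence

/-! ### Consequences of the greedy rule -/

namespace IsRun

variable {I} [Fintype L] {x : Fin n → Assignment L n → L → ℝ}

theorem isStrategy (hx : I.IsRun x) : IsStrategy x where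
  predictable j _ _ h := hx.adapted j _ _ fun k hk => h k hk
  nonneg j E i := by
    by_cases hE : ∃ i, I.Y E j i < 1
    · obtain ⟨ξ, hξ, h⟩ := hx.loop j E hE
      rw [h, ← hξ.start i]
      exact hξ.mono i (by simp) (by simp) zero_le_one
    · push Not at hE
      exact (hx.idle j E hE i).ge
  sum_le_one j E := by
    by_cases hE : ∃ i, I.Y E j i < 1
    · obtain ⟨ξ, hξ, h⟩ := hx.loop j E hE
      rw [h, hξ.total 1 (by simp)]
    · push Not at hE
      simp [hx.idle j E hE]

theorem score_le_of_pos (hx : I.IsRun x) {j : Fin n} {E : Assignment L n}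
    (hE : ∃ i, I.Y E j i < 1) {i : L} (hi : 0 < x j E i) (k : L) :
    I.score x E j (x j E) k ≤ I.gain E j i * (1 - I.B x E j i / I.budget i) := by
  obtain ⟨ξ, hξ, hx_eq⟩ := hx.loop j E hE
  rw [hx_eq] at hi ⊢
  have zero_mem : (0 : ℝ) ∈ Set.Icc (0 : ℝ) 1 := by simp
  have one_mem : (1 : ℝ) ∈ Set.Icc (0 : ℝ) 1 := by simp
  obtain ⟨u, hu, i_maximal⟩ :=
    hξ.greedy i 0 zero_mem 1 one_mem one_pos (by rwa [hξ.start])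
  have ξ_nonneg : ∀ k, 0 ≤ ξ u k := fun k => by
    rw [← hξ.start k]
    exact hξ.mono k zero_mem hu hu.1
  have ξ_le_final : ∀ k, ξ u k ≤ ξ 1 k := fun k => hξ.mono k hu one_mem hu.2
  have score_anti : ∀ {k s t}, 0 ≤ s → s ≤ t →
      I.gain E j k * (1 - (I.B x E j k + I.increaseB E j k 1 t) / I.budget k) ≤
        I.gain E j k * (1 - (I.B x E j k + I.increaseB E j k 1 s) / I.budget k) := by
    intro k s t hs hst
    have := I.increaseB_one_mono E j k hs (hs.trans hst) hst
    have := I.gain_nonneg E j k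
    have := (I.budget_pos k).le
    gcongr
  calc I.score x E j (ξ 1) k ≤ I.score x E j (ξ u) k := score_anti (ξ_nonneg k) (ξ_le_final k)
    _ ≤ I.score x E j (ξ u) i := i_maximal k
    _ ≤ _ := score_anti le_rfl (ξ_nonneg i)
    _ = _ := by rw [increaseB, intervalIntegral.integral_same, add_zero]

theorem score_le_sum (hx : I.IsRun x) {j : Fin n} {E : Assignment L n}
    (hE : ∃ i, I.Y E j i < 1) (k : L) :
    I.score x E j (x j E) k ≤
      ∑ i, x j E i * (I.gain E j i * (1 - I.B x E j i / I.budget i)) := by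
  have sum_eq_one : ∑ i, x j E i = 1 := by
    obtain ⟨ξ, hξ, h⟩ := hx.loop j E hE
    rw [h, hξ.total 1 (by simp)]
  calc I.score x E j (x j E) k = ∑ i, x j E i * I.score x E j (x j E) k := by
        rw [← sum_mul, sum_eq_one, one_mul]
    _ ≤ _ := sum_le_sum fun i _ => by
        rcases (hx.isStrategy.nonneg j E i).eq_or_lt with h | h
        · simp [← h]
        · exact mul_le_mul_of_nonneg_left (hx.score_le_of_pos hE h k) h.le

end IsRun

/-! ### Levels and their increments -/

section Levels

/-- The relative increase of the level `Y_i` if `j` is assigned to `i`. -/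
def increment (I : BudgetInstance L n) (i : L) (j : Fin n) (M : Assignment L n) : ℝ :=
  I.gain M j i / I.budget i

variable {I}

theorem Y_eq_realized (M : Assignment L n) (j : Fin n) (i : L) :
    I.Y M j i = realized i (I.increment i) j.castSucc M :=
  (partialSum_castSucc _ j).symm

theorem load_eq_realized (M : Assignment L n) (j : Fin n) (i : L) :
    I.load M j i = realized i (fun k _ => I.weight i k) j.castSucc M :=
  (partialSum_castSucc _ j).symm

theorem budget_mul_increment (M : Assignment L n) (j : Fin n) (i : L) :
    I.budget i * I.increment i j M = I.gain M j i :=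
  mul_div_cancel₀ _ (I.budget_pos i).ne'

theorem min_add_min_max_zero_sub (W S : ℝ) {w : ℝ} (hw : 0 ≤ w) :
    min W S + min w (max 0 (W - S)) = min W (S + w) := by
  rcases le_total W S with h | h
  · rw [min_eq_left h, max_eq_left (sub_nonpos.2 h), min_eq_right hw,
      min_eq_left (h.trans (le_add_of_nonneg_right hw)), add_zero]
  · rw [min_eq_right h, max_eq_right (sub_nonneg.2 h), ← min_add_add_left, add_sub_cancel,
      min_comm]

theorem budget_mul_realized (M : Assignment L n) (i : L) (t : Fin (n + 1)) :
    I.budget i * realized i (I.increment i) t M =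
      min (I.budget i) (realized i (fun k _ => I.weight i k) t M) := by
  induction t using Fin.induction with
  | zero => simp only [realized_zero, mul_zero, min_eq_right (I.budget_pos i).le]
  | succ j ih =>
    rw [realized_succ, realized_succ, mul_add, ih, ← mul_assoc, budget_mul_increment]
    rcases X_eq_zero_or_one M i j with h | h
    · simp only [h, mul_zero, add_zero]
    · rw [h, mul_one, mul_one, gain, load_eq_realized,
        min_add_min_max_zero_sub _ _ (I.weight_nonneg i j)]

theorem budget_mul_Y (M : Assignment L n) (j : Fin n) (i : L) :
    I.budget i * I.Y M j i = min (I.budget i) (I.load M j i) := by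
  rw [Y_eq_realized, budget_mul_realized, load_eq_realized]

theorem Y_add_increment_le_one (M : Assignment L n) (j : Fin n) (i : L) :
    I.Y M j i + I.increment i j M ≤ 1 := by
  refine le_of_mul_le_mul_left ?_ (I.budget_pos i)
  rw [mul_add, budget_mul_Y, budget_mul_increment, gain,
    min_add_min_max_zero_sub _ _ (I.weight_nonneg i j), mul_one]
  exact min_le_left _ _

theorem gain_eq_zero_of_one_le_Y {M : Assignment L n} {j : Fin n} {i : L} (h : 1 ≤ I.Y M j i) :
    I.gain M j i = 0 := by
  have increment_zero : I.increment i j M = 0 :=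
    le_antisymm (by linarith [I.Y_add_increment_le_one M j i]) (I.gain_div_budget_nonneg M j i)
  rw [← budget_mul_increment, increment_zero, mul_zero]

variable {δ : ℝ}

theorem one_sub_le_Y_of_gain_lt (hI : ∀ i j, I.weight i j ≤ δ * I.budget i) (hδ : 0 ≤ δ)
    {M : Assignment L n} {j : Fin n} {i : L} (h : I.gain M j i < I.weight i j) :
    1 - δ ≤ I.Y M j i := by
  have slack_lt : max 0 (I.budget i - I.load M j i) < I.weight i j :=
    (min_lt_iff.1 h).resolve_left (lt_irrefl _)
  have load_ge : I.budget i * (1 - δ) ≤ I.load M j i := by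
    linarith [(le_max_right _ _).trans_lt slack_lt, hI i j]
  have budget_ge : I.budget i * (1 - δ) ≤ I.budget i :=
    mul_le_of_le_one_right (I.budget_pos i).le (sub_le_self 1 hδ)
  refine le_of_mul_le_mul_left ?_ (I.budget_pos i)
  rw [budget_mul_Y]
  exact le_min budget_ge load_ge

theorem isSmallIncrement (hI : ∀ i j, I.weight i j ≤ δ * I.budget i) (i : L) :
    IsSmallIncrement i (I.increment i) δ where
  predictable j M M' h := by simp only [increment, gain_congr fun k hk => h k hk]
  nonneg j M := I.gain_div_budget_nonneg M j i
  le j M := (div_le_iff₀ (I.budget_pos i)).2 ((min_le_left _ _).trans (hI i j))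
  realized_add_le j M := by
    rw [← Y_eq_realized]
    exact Y_add_increment_le_one M j i

end Levels

/-! ### The dual variable of an offline vertex -/

section OfflineDual

/-- `B_i / W_i` at time `t`, the dual variable of `i`. -/
def relB (I : BudgetInstance L n) (x : Fin n → Assignment L n → L → ℝ) (i : L) (t : Fin (n + 1))
    (M : Assignment L n) : ℝ :=
  Fin.partialSum (fun k => I.increaseB M k i (X M i k / x k M i) (x k M i) / I.budget i) t

variable {I} {x : Fin n → Assignment L n → L → ℝ} {δ : ℝ}

theorem B_div_budget (x : Fin n → Assignment L n → L → ℝ) (i : L) (M : Assignment L n)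
    (j : Fin n) : I.B x M j i / I.budget i = I.relB x i j.castSucc M := by
  rw [relB, partialSum_castSucc, B, sum_div]

theorem increaseB_div_budget (M : Assignment L n) (j : Fin n) (i : L) (r s : ℝ) :
    I.increaseB M j i r s / I.budget i =
      I.increment i j M * g (realized i (I.increment i) j.castSucc M) * s +
        I.increment i j M * jump i (I.increment i) j M / 2 * (r * s ^ 2) := by
  rw [increaseB_eq, ← Y_eq_realized, jump, ← Y_eq_realized, increment]
  ring

theorem relB_succ (x : Fin n → Assignment L n → L → ℝ) (i : L) (j : Fin n) (M : Assignment L n) :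
    I.relB x i j.succ M = I.relB x i j.castSucc M +
      (I.increment i j M * g (realized i (I.increment i) j.castSucc M) * x j M i +
        I.increment i j M * jump i (I.increment i) j M / 2 * x j M i * X M i j) := by
  rw [relB, Fin.partialSum_succ, ← relB, increaseB_div_budget]
  rcases eq_or_ne (x j M i) 0 with h | _
  · simp [h]
  · field_simp

theorem increaseB_one_div_budget_nonneg {s : ℝ} (hs : 0 ≤ s) (M : Assignment L n) (j : Fin n)
    (i : L) : 0 ≤ I.increaseB M j i 1 s / I.budget i := by
  refine div_nonneg ?_ (I.budget_pos i).le
  simpa [increaseB] using I.increaseB_one_mono M j i Set.self_mem_Ici hs hs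

variable [Fintype L]

theorem mul_compensator_jump_le_relB (hI : ∀ i j, I.weight i j ≤ δ * I.budget i)
    (hx : IsStrategy x) (i : L) (t : Fin (n + 1)) (M : Assignment L n) :
    (1 - δ) * compensator x i (jump i (I.increment i)) t M ≤ I.relB x i t M := by
  have hd := isSmallIncrement hI i
  induction t using Fin.induction with
  | zero => rw [compensator_zero, mul_zero, relB, Fin.partialSum_zero]
  | succ j ih =>
    have x_nonneg := hx.nonneg j M i
    have main_term := mul_le_mul_of_nonneg_right (hd.one_sub_mul_jump_le j M) x_nonneg
    have correction_nonneg : 0 ≤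
        I.increment i j M * jump i (I.increment i) j M / 2 * x j M i * X M i j := by
      have := hd.nonneg j M
      have := hd.jump_nonneg j M
      have := X_nonneg M i j
      positivity
    rw [compensator_succ, relB_succ]
    linarith

theorem relB_le_mul_compensator_jump (hI : ∀ i j, I.weight i j ≤ δ * I.budget i)
    (hx : IsStrategy x) (i : L) (t : Fin (n + 1)) (M : Assignment L n) :
    I.relB x i t M ≤ (1 + δ) * compensator x i (jump i (I.increment i)) t M := by
  have hd := isSmallIncrement hI i
  induction t using Fin.induction with
  | zero => rw [compensator_zero, mul_zero, relB, Fin.partialSum_zero]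
  | succ j ih =>
    have drift_nonneg : 0 ≤ jump i (I.increment i) j M * x j M i :=
      mul_nonneg (hd.jump_nonneg j M) (hx.nonneg j M i)
    have main_term : I.increment i j M * g (realized i (I.increment i) j.castSucc M) * x j M i ≤
        jump i (I.increment i) j M * x j M i :=
      mul_le_mul_of_nonneg_right (mul_g_le_sub _ _) (hx.nonneg j M i)
    have increment_mul_X_le : I.increment i j M * X M i j ≤ δ :=
      (mul_le_of_le_one_right (hd.nonneg j M) (X_le_one M i j)).trans (hd.le j M)
    have correction := mul_le_mul_of_nonneg_right increment_mul_X_le drift_nonneg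
    have correction_nonneg :=
      mul_nonneg (mul_nonneg (hd.nonneg j M) (X_nonneg M i j)) drift_nonneg
    rw [compensator_succ, relB_succ]
    linarith

theorem relB_mono (hI : ∀ i j, I.weight i j ≤ δ * I.budget i) (hx : IsStrategy x) (i : L) :
    Monotone (I.relB x i) := by
  have hd := isSmallIncrement hI i
  refine Fin.monotone_iff_le_succ.2 fun j M => ?_
  rw [relB_succ]
  have := hd.nonneg j M
  have := hd.jump_nonneg j M
  have := hx.nonneg j M i
  have := X_nonneg M i j
  have := (g_pos (realized i (I.increment i) j.castSucc M)).le
  exact le_add_of_nonneg_right (by positivity)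

theorem expectedReward_relB_succ (hI : ∀ i j, I.weight i j ≤ δ * I.budget i)
    (hx : IsStrategy x) (i : L) (j : Fin n) :
    expectedReward x (fun M => (I.B x M j i + I.increaseB M j i 1 (x j M i)) / I.budget i) =
      expectedReward x (I.relB x i j.succ) := by
  have hd := isSmallIncrement hI i
  have correction_known : DependsOn (fun M =>
      I.increment i j M * jump i (I.increment i) j M / 2 * x j M i) (past j.castSucc) :=
    fun M M' h => by
      simp only [hd.predictable j h, hd.isPredictable_jump j h, hx.predictable j h]
  simp only [add_div, B_div_budget, increaseB_div_budget, funext (relB_succ x i j),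
    expectedReward_add, expectedReward_mul_X hx.predictable i j correction_known, one_mul, sq,
    ← mul_assoc]

end OfflineDual

/-! ### Dual feasibility -/

section DualFeasibility

variable [Fintype L]

/-- The positive parts of the scores before the arrival of `j`, averaged with the final fractions;
the dual variable of `j` is its expectation. -/
def payment (I : BudgetInstance L n) (x : Fin n → Assignment L n → L → ℝ) (j : Fin n)
    (M : Assignment L n) : ℝ :=
  ∑ i, I.budget i * (I.increment i j M * max 0 (1 - I.relB x i j.castSucc M) * x j M i)

variable {I} {x : Fin n → Assignment L n → L → ℝ} {δ : ℝ}

theorem payment_nonneg (hx : IsStrategy x) (j : Fin n) (M : Assignment L n) :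
    0 ≤ I.payment x j M :=
  sum_nonneg fun i _ => mul_nonneg (I.budget_pos i).le <| mul_nonneg
    (mul_nonneg (I.gain_div_budget_nonneg M j i) (le_max_left _ _)) (hx.nonneg j M i)

theorem IsRun.score_le_payment (hx : I.IsRun x) (j : Fin n) (M : Assignment L n) (k : L) :
    I.score x M j (x j M) k ≤ I.payment x j M := by
  by_cases hM : ∃ i, I.Y M j i < 1
  · refine (hx.score_le_sum hM k).trans (sum_le_sum fun i _ => ?_)
    rw [B_div_budget, ← budget_mul_increment]
    have rate_nonneg : 0 ≤ I.budget i * (I.increment i j M * x j M i) :=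
      mul_nonneg (I.budget_pos i).le
        (mul_nonneg (I.gain_div_budget_nonneg M j i) (hx.isStrategy.nonneg j M i))
    have := mul_le_mul_of_nonneg_left (le_max_right 0 (1 - I.relB x i j.castSucc M)) rate_nonneg
    linarith
  · push Not at hM
    rw [score, gain_eq_zero_of_one_le_Y (hM k), zero_mul]
    exact payment_nonneg hx.isStrategy j M

theorem one_sub_relB_le_of_gain_lt (hI : ∀ i j, I.weight i j ≤ δ * I.budget i) (hδ₀ : 0 ≤ δ)
    (hδ₁ : δ ≤ 1) (hx : IsStrategy x) {k : L} {j : Fin n} {M : Assignment L n}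
    (h : I.gain M j k < I.weight k j) :
    1 - I.relB x k j.castSucc M ≤ 3 * δ + |noise x k (jump k (I.increment k)) j.castSucc M| := by
  have level_ge : g (1 - δ) ≤ g (realized k (I.increment k) j.castSucc M) := by
    rw [← Y_eq_realized]
    exact g_mono (one_sub_le_Y_of_gain_lt hI hδ₀ h)
  have g_gap := sub_le_mul_g (1 - δ) δ
  rw [sub_add_cancel] at g_gap
  have := mul_le_mul_of_nonneg_left g_one_le_two hδ₀
  have slack_le := (le_max_right _ _).trans ((isSmallIncrement hI k).max_one_sub_le hδ₀ hδ₁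
    (mul_compensator_jump_le_relB hI hx k j.castSucc M))
  rw [← g_realized_sub_g_zero] at slack_le
  linarith [g_one_eq]

theorem weight_mul_one_sub_le_score_add (hI : ∀ i j, I.weight i j ≤ δ * I.budget i)
    (hδ₀ : 0 ≤ δ) (hδ₁ : δ ≤ 1) (hx : IsStrategy x) (k : L) (j : Fin n) (M : Assignment L n) :
    I.weight k j * (1 - (I.B x M j k + I.increaseB M j k 1 (x j M k)) / I.budget k) ≤
      I.score x M j (x j M) k +
        I.weight k j * (3 * δ + |noise x k (jump k (I.increment k)) j.castSucc M|) := by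
  set err := 3 * δ + |noise x k (jump k (I.increment k)) j.castSucc M|
  have err_nonneg : 0 ≤ err := by positivity
  have gain_le : I.gain M j k ≤ I.weight k j := min_le_left _ _
  rw [score]
  rcases gain_le.eq_or_lt with h | h
  · rw [h]
    exact le_add_of_nonneg_right (mul_nonneg (I.weight_nonneg k j) err_nonneg)
  · have slack_le :
        1 - (I.B x M j k + I.increaseB M j k 1 (x j M k)) / I.budget k ≤ err := by
      rw [add_div, B_div_budget]
      linarith [one_sub_relB_le_of_gain_lt hI hδ₀ hδ₁ hx h,
        I.increaseB_one_div_budget_nonneg (hx.nonneg j M k) M j k]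
    have := mul_le_mul_of_nonneg_left slack_le (sub_nonneg.2 gain_le)
    have := mul_nonneg (I.gain_nonneg M j k) err_nonneg
    linarith

variable {θ : ℝ}

theorem IsRun.dual_feasible (hθ₀ : 0 < θ) (hθ₁ : θ ≤ 1 / 2)
    (hI : ∀ i j, I.weight i j ≤ θ ^ 2 * I.budget i) (hx : I.IsRun x) (k : L) (j : Fin n) :
    I.weight k j * (1 - 3 * θ - expectedReward x (I.relB x k (Fin.last n))) ≤
      expectedReward x (I.payment x j) := by
  have hs := hx.isStrategy
  have hw := I.weight_nonneg k j
  have hθ_sq : θ ^ 2 ≤ θ / 2 := by nlinarith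
  have pointwise := hs.expectedReward_mono fun M =>
    (weight_mul_one_sub_le_score_add hI (sq_nonneg θ) (by linarith) hs k j M).trans
      (add_le_add_left (hx.score_le_payment j M k) _)
  simp only [expectedReward_add, expectedReward_const_mul, expectedReward_sub,
    expectedReward_const hs.predictable, expectedReward_relB_succ hI hs] at pointwise
  have noise_le : 3 * θ ^ 2 + expectedReward x
      (fun M => |noise x k (jump k (I.increment k)) j.castSucc M|) ≤ 3 * θ := by
    linarith [(isSmallIncrement hI k).expectedReward_abs_noise_le hθ₀ hs j.castSucc]
  have relB_le_last := hs.expectedReward_mono (relB_mono hI hs k (Fin.le_last j.succ))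
  have := mul_le_mul_of_nonneg_left noise_le hw
  have := mul_le_mul_of_nonneg_left relB_le_last hw
  linarith

end DualFeasibility

/-! ### The competitive ratio -/

section CompetitiveRatio

variable [Fintype L]

/-- The reward of an assignment under additive budgets. -/
def reward (I : BudgetInstance L n) (M : Assignment L n) : ℝ :=
  ∑ i, min (I.budget i) (∑ j with M j = some i, I.weight i j)

/-- The offline optimum under additive budgets. -/
def opt (I : BudgetInstance L n) : ℝ :=
  (univ : Finset (Assignment L n)).sup' univ_nonempty I.reward

variable {I} {x : Fin n → Assignment L n → L → ℝ}

theorem reward_nonneg (M : Assignment L n) : 0 ≤ I.reward M :=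
  sum_nonneg fun i _ => le_min (I.budget_pos i).le (sum_nonneg fun j _ => I.weight_nonneg i j)

theorem reward_eq_sum_budget_mul_realized (M : Assignment L n) :
    I.reward M = ∑ i, I.budget i * realized i (I.increment i) (Fin.last n) M := by
  simp only [budget_mul_realized]
  simp only [realized, partialSum_last, reward, sum_filter, X, mul_ite, mul_one, mul_zero]

theorem sum_sum_filter_eq_some_le {A : Fin n → ℝ} (hA : ∀ j, 0 ≤ A j) (M : Assignment L n) :
    ∑ k, ∑ j with M j = some k, A j ≤ ∑ j, A j := by
  simp only [sum_filter]
  rw [sum_comm]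
  refine sum_le_sum fun j _ => ?_
  cases h : M j <;> simp [hA]

theorem weak_duality {A : Fin n → ℝ} {β : L → ℝ} {c : ℝ} (hA : ∀ j, 0 ≤ A j) (hβ : ∀ k, 0 ≤ β k)
    (feasible : ∀ k j, I.weight k j * (c - β k) ≤ A j) (M : Assignment L n) :
    c * I.reward M ≤ ∑ k, I.budget k * β k + ∑ j, A j := by
  have vertex_le : ∀ k, c * min (I.budget k) (∑ j with M j = some k, I.weight k j) ≤
      I.budget k * β k + ∑ j with M j = some k, A j := by
    intro k
    set S := ∑ j with M j = some k, I.weight k j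
    have S_nonneg : 0 ≤ S := sum_nonneg fun j _ => I.weight_nonneg k j
    have offline_part : min (I.budget k) S * β k ≤ I.budget k * β k :=
      mul_le_mul_of_nonneg_right (min_le_left _ _) (hβ k)
    have online_part : min (I.budget k) S * (c - β k) ≤ ∑ j with M j = some k, A j := by
      rcases le_total (c - β k) 0 with h | h
      · exact (mul_nonpos_of_nonneg_of_nonpos (le_min (I.budget_pos k).le S_nonneg) h).trans
          (sum_nonneg fun j _ => hA j)
      · refine (mul_le_mul_of_nonneg_right (min_le_right _ _) h).trans ?_
        rw [sum_mul]
        exact sum_le_sum fun j _ => feasible k j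
    linarith
  calc c * I.reward M = ∑ k, c * min (I.budget k) (∑ j with M j = some k, I.weight k j) :=
        mul_sum _ _ _
    _ ≤ ∑ k, (I.budget k * β k + ∑ j with M j = some k, A j) :=
        sum_le_sum fun k _ => vertex_le k
    _ = ∑ k, I.budget k * β k + ∑ k, ∑ j with M j = some k, A j := sum_add_distrib
    _ ≤ ∑ k, I.budget k * β k + ∑ j, A j := add_le_add_right (sum_sum_filter_eq_some_le hA M) _

theorem sum_payment (x : Fin n → Assignment L n → L → ℝ) (M : Assignment L n) :
    ∑ j, I.payment x j M = ∑ k, I.budget k * compensator x k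
      (fun j M => I.increment k j M * max 0 (1 - I.relB x k j.castSucc M)) (Fin.last n) M := by
  simp only [payment, compensator, partialSum_last, mul_sum]
  exact sum_comm

variable {θ : ℝ}

theorem dual_objective_le (hθ₀ : 0 < θ) (hθ₁ : θ ≤ 1 / 2)
    (hI : ∀ i j, I.weight i j ≤ θ ^ 2 * I.budget i) (hx : IsStrategy x) :
    ∑ k, I.budget k * expectedReward x (I.relB x k (Fin.last n)) +
        ∑ j, expectedReward x (I.payment x j) ≤
      (g 1 + 4 * θ) * expectedReward x I.reward := by
  rw [← expectedReward_sum, funext reward_eq_sum_budget_mul_realized]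
  simp only [sum_payment, expectedReward_sum, expectedReward_const_mul]
  rw [← sum_add_distrib, mul_sum]
  refine sum_le_sum fun k _ => ?_
  have vertex_le := (isSmallIncrement hI k).expectedReward_dual_le hθ₀ hθ₁ hx
    (mul_compensator_jump_le_relB hI hx k) (relB_le_mul_compensator_jump hI hx k) (Fin.last n)
  linarith [mul_le_mul_of_nonneg_left vertex_le (I.budget_pos k).le]

theorem IsRun.mul_reward_le (hθ₀ : 0 < θ) (hθ₁ : θ ≤ 1 / 2)
    (hI : ∀ i j, I.weight i j ≤ θ ^ 2 * I.budget i) (hx : I.IsRun x) (M : Assignment L n) :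
    (1 - 3 * θ) * I.reward M ≤ (g 1 + 4 * θ) * expectedReward x I.reward := by
  have hs := hx.isStrategy
  have expectation_nonneg : ∀ {F}, (∀ M, 0 ≤ F M) → 0 ≤ expectedReward x F := fun hF =>
    (expectedReward_const hs.predictable 0).symm.trans_le (hs.expectedReward_mono hF)
  have relB_nonneg : ∀ k M, 0 ≤ I.relB x k (Fin.last n) M := fun k M =>
    (Fin.partialSum_zero _).symm.trans_le (relB_mono hI hs k (Fin.zero_le _) M)
  exact (weak_duality (fun j => expectation_nonneg (payment_nonneg hs j))
    (fun k => expectation_nonneg (relB_nonneg k)) (hx.dual_feasible hθ₀ hθ₁ hI) M).trans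
    (dual_objective_le hθ₀ hθ₁ hI hs)

theorem ratio_sub_mul_le {ε : ℝ} (hθ : 0 ≤ θ) (hθε : 7 * θ ≤ ε) :
    (1 - 1 / Real.exp 1 - ε) * (g 1 + 4 * θ) ≤ 1 - 3 * θ := by
  have ratio_mul_g_one : (1 - 1 / Real.exp 1) * g 1 = 1 := by
    rw [g_one, mul_inv_cancel₀ one_sub_inv_exp_pos.ne']
  have ratio_le_one : 1 - 1 / Real.exp 1 ≤ 1 := sub_le_self 1 (by positivity)
  have one_le_g_one : 1 ≤ g 1 := by rw [g_one_eq]; linarith [g_pos 0]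
  have hε : 0 ≤ ε := by linarith
  have := mul_le_mul_of_nonneg_left one_le_g_one hε
  have := mul_le_mul_of_nonneg_right ratio_le_one hθ
  have := mul_nonneg hε hθ
  linarith

theorem IsRun.ratio_sub_mul_opt_le {ε : ℝ} (hθ₀ : 0 < θ) (hθ₁ : θ ≤ 1 / 2) (hθε : 7 * θ ≤ ε)
    (hI : ∀ i j, I.weight i j ≤ θ ^ 2 * I.budget i) (hx : I.IsRun x) :
    (1 - 1 / Real.exp 1 - ε) * I.opt ≤ expectedReward x I.reward := by
  obtain ⟨M, -, hM⟩ := exists_mem_eq_sup' (univ_nonempty (α := Assignment L n)) I.reward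
  have hg : 0 < g 1 + 4 * θ := by linarith [g_pos 1]
  refine le_of_mul_le_mul_left ?_ hg
  calc (g 1 + 4 * θ) * ((1 - 1 / Real.exp 1 - ε) * I.opt)
      = (1 - 1 / Real.exp 1 - ε) * (g 1 + 4 * θ) * I.reward M := by rw [opt, hM]; ring
    _ ≤ (1 - 3 * θ) * I.reward M :=
        mul_le_mul_of_nonneg_right (ratio_sub_mul_le hθ₀.le hθε) (reward_nonneg M)
    _ ≤ (g 1 + 4 * θ) * expectedReward x I.reward := hx.mul_reward_le hθ₀ hθ₁ hI M

end CompetitiveRatio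

end BudgetInstance

theorem StochasticInstance.reward_toBudget {L : Type*} [Fintype L] [DecidableEq L] {n : ℕ}
    (I : StochasticInstance L n) : I.toBudget.reward = I.reward := by
  funext M
  refine sum_congr rfl fun i _ => ?_
  rw [mul_min_of_nonneg _ _ (I.weight_pos i).le, mul_one, mul_sum]
  rfl

theorem StochasticInstance.opt_toBudget {L : Type*} [Fintype L] [DecidableEq L] {n : ℕ}
    (I : StochasticInstance L n) : I.toBudget.opt = I.opt := by
  rw [BudgetInstance.opt, I.reward_toBudget, StochasticInstance.opt]

end OnlineMatching

end

theorem mainTheorem3_general (ε : ℝ) (hε : 0 < ε) :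
    ∃ δ : ℝ, 0 < δ ∧
      ∀ (L : Type*) [Fintype L] [DecidableEq L] (n : ℕ) (I : OnlineMatching.BudgetInstance L n),
        (∀ i j, I.weight i j ≤ δ * I.budget i) →
          (∃ x : Fin n → OnlineMatching.Assignment L n → L → ℝ, I.IsRun x) ∧
          ∀ x : Fin n → OnlineMatching.Assignment L n → L → ℝ, I.IsRun x →
            (1 - 1 / Real.exp 1 - ε) * I.opt ≤ OnlineMatching.expectedReward x I.reward := by
  have hθ₀ : 0 < min (1 / 2) (ε / 7) := lt_min (by norm_num) (by positivity)
  have hθε : 7 * min (1 / 2) (ε / 7) ≤ ε := by linarith [min_le_right (1 / 2) (ε / 7)]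
  exact ⟨min (1 / 2) (ε / 7) ^ 2, by positivity, fun L _ _ n I hI =>
    ⟨⟨I.run, I.isRun_run⟩, fun x hx => hx.ratio_sub_mul_opt_le hθ₀ (min_le_left _ _) hθε hI⟩⟩

theorem mainTheorem3 (ε : ℝ) (hε : 0 < ε) :
    ∃ δ : ℝ, 0 < δ ∧
      ∀ (L : Type*) [Fintype L] [DecidableEq L] (n : ℕ)
        (I : OnlineMatching.StochasticInstance L n),
        (∀ i j, I.prob i j ≤ δ) →
          (∃ x : Fin n → OnlineMatching.Assignment L n → L → ℝ, I.toBudget.IsRun x) ∧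
          ∀ x : Fin n → OnlineMatching.Assignment L n → L → ℝ, I.toBudget.IsRun x →
            (1 - 1 / Real.exp 1 - ε) * I.opt ≤ OnlineMatching.expectedReward x I.reward := by
  obtain ⟨δ, hδ, general⟩ := mainTheorem3_general ε hε
  refine ⟨δ, hδ, fun L _ _ n I hp => ?_⟩
  have result := general L n I.toBudget fun i j =>
    (mul_le_mul_of_nonneg_left (hp i j) (I.weight_pos i).le).trans_eq (mul_comm _ _)
  simpa only [I.opt_toBudget, I.reward_toBudget] using result
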